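/- Consider a complete family of $L$-loop Feynman integrals with $E-1$ independent external momenta $p_1,\dots,p_{E-1}$ and $p$ propagators, with squared masses $m_a^2>0$ and momenta $q_a=\sum_{j=1}^{L}\alpha_{aj}k_j+\sum_{r=1}^{E-1}\beta_{ar}p_r$, $\alpha_{aj},\beta_{ar}\in\{-1,0,1\}$: $$I(x;\nu;D)=\int\Big(\prod_{j=1}^{L}e^{\gamma_E\epsilon}\frac{\mathrm d^Dk_j}{i\pi^{D/2}}\Big)\prod_{a=1}^{p}\frac{1}{(m_a^2-q_a^2-i0)^{\nu_a}},\qquad \nu\in\mathbb Z^p,\quad D=D_0-2\epsilon,\quad D_0\in\mathbb N,\ \epsilon\in\mathbb C .$$ Here $x$ consists of the real products $p_r\cdot p_s$ and the $m_a^2$. Complete means that the affine map from the products $k_i\cdot k_j$ $(i\le j)$ and $k_i\cdot p_r$ to the inverse propagators $z_a=m_a^2-q_a^2$ is invertible. The integrals are understood in dimensional regularisation: for $\eta>0$ replace $m_a^2$ by $m_a^2-i\eta$, define the integral for $\operatorname{Re}D\ll0$ by its Schwinger representation (with exponents $\nu_a\le0$ by analytic continuation in $\nu_a$), continue it meromorphically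 in $D\in\mathbb C$, evaluate at a $D$ which is not a pole, and let $\eta\to0^+$. The integral $I(x;\nu;D)$ exists if there is no pole at $D$ for small $\eta$ and the limit is finite. Let $K=L+E-1$, let $G(p_1,\dots,p_{E-1})=\det(p_r\cdot p_s)$ (equal to $1$ if $E=1$), and let the Baikov polynomial $\mathcal B(z_1,\dots,z_p)$ be the Gram determinant $G(k_1,\dots,k_L,p_1,\dots,p_{E-1})$ written as a polynomial in the $z_a$. Let $(y)_L=y(y+1)\cdots(y+L-1)$, and let $b_a$ be the operator that lowers the exponent $\nu_a$ by one, so that $b_a^{c}\,I(x;\nu;D)=I(x;\nu_1,\dots,\nu_a-c,\dots,\nu_p;D)$. Assume $G(p_1,\dots,p_{E-1})\ne0$ and $(D-K+1)_L\neq0$, and let $\nu\in\mathbb Z^p$ be such that $I(x;\nu';D)$ exists for every $\nu'\in\mathbb Z^p$ with $\nu'\le\nu$ componentwise. Then $I(x;\nu;D+2)$ (that is, $D_0$ is replaced by $D_0+2$ with the same $\epsilon$) exists, and $$I(x;\nu;D+2)=\frac{(-2)^L}{G(p_1,\dots,p_{E-1})\,(D-K+1)_L}\;\mathcal B(b_1,\dots,b_p)\,I(x;\nu;D).$$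 -/

import Mathlib

open Filter Topology MeasureTheory

noncomputable section

namespace FeynmanIntegral

/-! ### Complete families of propagators -/

/-- Labels of the independent dot products that involve at least one of the `L` loop momenta:
`inl s(i, j)` stands for `k_i · k_j`, and `inr (i, r)` stands for `k_i · p_r`, where
`p_0, …, p_{n-1}` are the `n = E - 1` independent external momenta. -/
abbrev DotIdx (L n : ℕ) : Type := Sym2 (Fin L) ⊕ (Fin L × Fin n)

/-- For `q_a = ∑ j, α a j • k_j + ∑ r, β a r • p_r`, the part of `q_a ^ 2` that depends on the loop
momenta, as a linear function of the dot products: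
`∑ i j, α a i * α a j * (k_i · k_j) + 2 * ∑ i r, α a i * β a r * (k_i · p_r)`. -/
def dotMap {L n p : ℕ} (α : Fin p → Fin L → ℤ) (β : Fin p → Fin n → ℤ) :
    (DotIdx L n → ℝ) →ₗ[ℝ] (Fin p → ℝ) :=
  LinearMap.pi fun a =>
    (∑ i, ∑ j, ((α a i * α a j : ℤ) : ℝ) • LinearMap.proj (Sum.inl s(i, j))) +
      ∑ i, ∑ r, ((2 * (α a i * β a r) : ℤ) : ℝ) • LinearMap.proj (Sum.inr (i, r))

/-- A complete family of propagators with `L` loop momenta, `n = E - 1` independent external momenta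
and `p` propagator momenta `q_a = ∑ j, α a j • k_j + ∑ r, β a r • p_r`: the change of variables
from the dot products to the inverse propagators `z_a = m_a ^ 2 - q_a ^ 2` is invertible. -/
structure CompleteFamily (L n p : ℕ) where
  α : Fin p → Fin L → ℤ
  β : Fin p → Fin n → ℤ
  α_mem : ∀ a j, α a j = -1 ∨ α a j = 0 ∨ α a j = 1
  β_mem : ∀ a r, β a r = -1 ∨ β a r = 0 ∨ β a r = 1
  complete : Function.Bijective (dotMap α β)

namespace CompleteFamily

variable {L n p : ℕ} (F : CompleteFamily L n p)

/-! ### Schwinger representation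

Here `S r s = p_r · p_s` are the external dot products, and `M a` is the squared mass of the
propagator `a` (complex, since it absorbs the Feynman prescription `m_a ^ 2 - iη`). -/

/-- `(∑ r, β a r • p_r) ^ 2`, the part of `q_a ^ 2` that does not depend on the loop momenta. -/
def extSq (S : Matrix (Fin n) (Fin n) ℝ) (a : Fin p) : ℝ :=
  ∑ r, ∑ s, (F.β a r : ℝ) * F.β a s * S r s

/-- The matrix of the quadratic form `∑ a, s_a * q_a ^ 2` in the loop momenta. -/
def quadMatrix (s : Fin p → ℝ) : Matrix (Fin L) (Fin L) ℝ :=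
  Matrix.of fun i j => ∑ a, s a * F.α a i * F.α a j

/-- The coefficients of `∑ a, s_a * q_a ^ 2` at the products `2 * (k_i · p_r)`. -/
def linMatrix (s : Fin p → ℝ) : Matrix (Fin L) (Fin n) ℝ :=
  Matrix.of fun i r => ∑ a, s a * F.α a i * F.β a r

/-- The first Symanzik polynomial `𝒰`. -/
def symanzikU (s : Fin p → ℝ) : ℝ := (F.quadMatrix s).det

/-- The mass-independent part of the second Symanzik polynomial. -/
def symanzikFtilde (S : Matrix (Fin n) (Fin n) ℝ) (s : Fin p → ℝ) : ℝ :=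
  ((F.quadMatrix s).adjugate * (F.linMatrix s * S * (F.linMatrix s).transpose)).trace -
    F.symanzikU s * ∑ a, s a * F.extSq S a

/-- The second Symanzik polynomial `ℱ = 𝒰 * ∑ a, M_a * s_a + ℱ̃`. -/
def symanzikF (S : Matrix (Fin n) (Fin n) ℝ) (M : Fin p → ℂ) (s : Fin p → ℝ) : ℂ :=
  F.symanzikU s * ∑ a, M a * s a + F.symanzikFtilde S s

/-- `𝒰 ^ (-D/2) * exp (-ℱ / 𝒰)` at the Schwinger parameters `i * s_a`, `s_a > 0`, up to the
constant factor `i ^ (-L * D / 2)`. -/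
def schwingerKernel (S : Matrix (Fin n) (Fin n) ℝ) (M : Fin p → ℂ) (D : ℂ) (s : Fin p → ℝ) : ℂ :=
  (F.symanzikU s : ℂ) ^ (-D / 2) *
    Complex.exp (-Complex.I * (F.symanzikF S M s / F.symanzikU s))

end CompleteFamily

/-- The partial derivative with respect to the `a`-th coordinate. -/
def partialDeriv {p : ℕ} (a : Fin p) (f : (Fin p → ℝ) → ℂ) : (Fin p → ℝ) → ℂ :=
  fun s => deriv (fun t => f (Function.update s a t)) (s a)

/-- The mixed partial derivative of order `m a` in the `a`-th coordinate, for all `a`. -/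
def mixedPartial {p : ℕ} (m : Fin p → ℕ) (f : (Fin p → ℝ) → ℂ) : (Fin p → ℝ) → ℂ :=
  (List.finRange p).foldr (fun a g => (partialDeriv a)^[m a] g) f

/-- The open orthant of Schwinger parameters. -/
def orthant (p : ℕ) : Set (Fin p → ℝ) := {s | ∀ a, 0 < s a}

namespace CompleteFamily

variable {L n p : ℕ} (F : CompleteFamily L n p)

/-- The integrand of the Schwinger representation for integer exponents. For `ν a ≥ 1`, the
propagator `a` contributes the usual density `s_a ^ (ν_a - 1) / Γ(ν_a)`. For `ν a ≤ 0` this density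
is understood, as always, by analytic continuation in the exponent, that is, as
`(d/ds_a) ^ (1 - ν_a)` of the unit step in the sense of distributions: the derivatives are moved to
the kernel. -/
def schwingerIntegrand (S : Matrix (Fin n) (Fin n) ℝ) (M : Fin p → ℂ) (ν : Fin p → ℤ) (D : ℂ)
    (s : Fin p → ℝ) : ℂ :=
  (∏ a, ((s a : ℂ) ^ (ν a - 1).toNat / ((ν a - 1).toNat.factorial : ℂ) *
      (-1) ^ (1 - ν a).toNat)) *
    mixedPartial (fun a => (1 - ν a).toNat) (F.schwingerKernel S M D) s

/-- The Schwinger representation of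
`∫ ∏ j, (d^D k_j / (i π ^ (D/2))) * ∏ a, (M_a - q_a ^ 2) ^ (-ν_a)`, `Im M_a < 0`. It comes from
`X ^ (-ν) = i ^ ν / Γ(ν) * ∫_0^∞ s ^ (ν - 1) * exp (-i s X) ds`, `Im X < 0`, that is, the Schwinger
parameters run along the positive imaginary axis, as required in Minkowski kinematics. The first
factor is `i ^ (-L * D / 2)`. -/
def schwingerIntegral (S : Matrix (Fin n) (Fin n) ℝ) (M : Fin p → ℂ) (ν : Fin p → ℤ) (D : ℂ) : ℂ :=
  Complex.exp (-(Real.pi * Complex.I * L * D / 4)) * (∏ a, Complex.I ^ (ν a)) *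
    ∫ s in orthant p, F.schwingerIntegrand S M ν D s

/-- `J` is the dimensionally regularised integral with squared masses `M a`, `Im (M a) < 0`, as a
function of `D`: it is meromorphic on `ℂ`, and it is given by the absolutely convergent Schwinger
representation when the real part of `D` is sufficiently negative. -/
def IsDimReg (S : Matrix (Fin n) (Fin n) ℝ) (M : Fin p → ℂ) (ν : Fin p → ℤ) (J : ℂ → ℂ) : Prop :=
  Meromorphic J ∧ ∃ R : ℝ, ∀ D : ℂ, D.re < R →
    IntegrableOn (F.schwingerIntegrand S M ν D) (orthant p) ∧ J D = F.schwingerIntegral S M ν D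

/-- `I(x; ν; D₀ - 2ε) = v`: the propagator denominators are `m_a ^ 2 - q_a ^ 2 - iη` with `η → 0⁺`,
and for each small `η` the integral is dimensionally regularised and has no pole at
`D = D₀ - 2ε`; every loop carries the normalisation `e ^ (γ ε)`. -/
def HasValue (S : Matrix (Fin n) (Fin n) ℝ) (m2 : Fin p → ℝ) (ν : Fin p → ℤ) (D₀ : ℕ) (ε : ℂ)
    (v : ℂ) : Prop :=
  ∃ J : ℝ → ℂ → ℂ,
    (∀ᶠ η : ℝ in 𝓝[>] 0, F.IsDimReg S (fun a => m2 a - Complex.I * η) ν (J η) ∧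
      AnalyticAt ℂ (J η) (D₀ - 2 * ε)) ∧
    Tendsto (fun η : ℝ =>
      Complex.exp (Real.eulerMascheroniConstant * L * ε) * J η (D₀ - 2 * ε)) (𝓝[>] 0) (𝓝 v)

/-! ### The Baikov polynomial -/

/-- The dot product with label `e`, as a polynomial (of degree one) in the inverse propagators
`z_a = M_a - q_a ^ 2`: the inverse of `dotMap` applied to the vector `M_a - extSq a - z_a`. -/
def dotPoly (S : Matrix (Fin n) (Fin n) ℝ) (M : Fin p → ℂ) (e : DotIdx L n) :
    MvPolynomial (Fin p) ℂ :=
  ∑ a, MvPolynomial.C (((LinearEquiv.ofBijective (dotMap F.α F.β) F.complete).symm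
      (Pi.single a 1) e : ℝ) : ℂ) *
    (MvPolynomial.C (M a - F.extSq S a) - MvPolynomial.X a)

/-- The Baikov polynomial: the Gram determinant `G(k_1, …, k_L, p_1, …, p_{E-1})`, as a polynomial in
the inverse propagators. -/
def baikovPoly (S : Matrix (Fin n) (Fin n) ℝ) (M : Fin p → ℂ) : MvPolynomial (Fin p) ℂ :=
  (Matrix.fromBlocks
    (Matrix.of fun i j : Fin L => F.dotPoly S M (Sum.inl s(i, j)))
    (Matrix.of fun (i : Fin L) (r : Fin n) => F.dotPoly S M (Sum.inr (i, r)))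
    (Matrix.of fun (r : Fin n) (i : Fin L) => F.dotPoly S M (Sum.inr (i, r)))
    (S.map fun x : ℝ => (MvPolynomial.C (x : ℂ) : MvPolynomial (Fin p) ℂ))).det

end CompleteFamily

/-- `B(b_1, …, b_p) I`, evaluated at `ν`, where `b_a` lowers the exponent `ν_a` by one. -/
def applyLowering {p : ℕ} (B : MvPolynomial (Fin p) ℂ) (I : (Fin p → ℤ) → ℂ) (ν : Fin p → ℤ) : ℂ :=
  ∑ m ∈ B.support, B.coeff m * I (fun a => ν a - (m a : ℤ))

end FeynmanIntegral

end

/-! In the Schwinger representation, lowering `ν_a` amounts to applying `i ∂/∂s_a` to the kernel `E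
= 𝒰 ^ (-D/2) * exp (-i ℱ/𝒰)`: for `ν_a ≤ 1` by the definition of the continued exponents, for `ν_a ≥
2` by integration by parts (`pairing_lower_one`). Hence `ℬ(b)` acts on the integrand as the
differential operator `ℬ(i∂)`, and the heart of the matter is that `ℬ(i∂) E` is a constant multiple
of `E/𝒰`, the kernel in dimension `D + 2` (`KernelModel.op_baikovPoly`).

Let `A` and `B` be the matrices of quadratic and linear coefficients, so that `𝒰 = det A` and `ℱ/𝒰`
is a linear form plus `tr (A⁻¹ B S Bᵀ)`. By completeness the entries of `A` (up to symmetry) and `B`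
are independent coordinates, and the operator attached to a dot product is, up to a constant, the
derivative in one of them. The Gram determinant is `det S` times the determinant of a Schur
complement. On the kernel the external momenta merely shift the exponent `w = -D/2` of `det A` by
`n/2` (`op_schur`). What remains is Cayley's identity for symmetric matrices, `det(∂) (det A)^s = s
(s + 1/2) ⋯ (s + (L-1)/2) (det A)^(s-1)`, proved for all minors by row expansion (`sum_deriv_minor`,
`op_det_schur`); its product is the Pochhammer factor. This computation lives in an abstract
differential algebra, `KernelModel`, of which smooth functions on the orthant are an instance.

Analytically, `𝒰 > 0` on the orthant and `Im M_a = -η` gives exponential decay. When `Re D` is very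
negative, differentiation leaves nonnegative powers of `𝒰`, so everything is integrable and boundary
terms vanish; the recurrence holds there (`applyLowering_schwingerIntegral`). The combination of
lowered integrals, divided by the Pochhammer factor, is meromorphic and therefore serves as the
continuation in the raised dimension. It is analytic at the required point because that factor is
nonzero there, and `η → 0⁺` is taken term by term because the coefficients of `ℬ` are polynomials in
`η`. -/

namespace FeynmanIntegral

/-! ### Derivations, determinants and minors -/

section Algebra

/-- The evaluation of a polynomial at a commuting family of elements of an algebra. -/
noncomputable def evalCommuting {p : ℕ} {A : Type*} [Ring A] [Algebra ℂ A] (T : Fin p → A)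
    (hT : ∀ a b, T a * T b = T b * T a) : MvPolynomial (Fin p) ℂ →ₐ[ℂ] A :=
  letI : CommRing (Algebra.adjoin ℂ (Set.range T)) :=
    { (inferInstance : Ring (Algebra.adjoin ℂ (Set.range T))) with
      mul_comm := (Algebra.isMulCommutative_adjoin ℂ (s := Set.range T)
        (by rintro _ ⟨a, rfl⟩ _ ⟨b, rfl⟩; exact hT a b)).is_comm.comm }
  (Algebra.adjoin ℂ (Set.range T)).val.comp
    (MvPolynomial.aeval fun a => ⟨T a, Algebra.subset_adjoin ⟨a, rfl⟩⟩)

theorem evalCommuting_X {p : ℕ} {A : Type*} [Ring A] [Algebra ℂ A] (T : Fin p → A)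
    (hT : ∀ a b, T a * T b = T b * T a) (a : Fin p) :
    evalCommuting T hT (MvPolynomial.X a) = T a := by
  simp [evalCommuting]

variable {R : Type*} [CommRing R]

theorem det_updateRow_eq_sum {ι : Type*} [DecidableEq ι] [Fintype ι] (M : Matrix ι ι R) (a : ι)
    (v : ι → R) :
    (M.updateRow a v).det = ∑ c, v c * (M.updateRow a (Pi.single c 1)).det := by
  rw [Matrix.det_eq_sum_mul_adjugate_row _ a]
  simp [Matrix.adjugate_apply]

theorem det_swap_rows {ι : Type*} [DecidableEq ι] [Fintype ι] (M : Matrix ι ι R) {a b : ι}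
    (hab : a ≠ b) (u v : ι → R) :
    ((M.updateRow a u).updateRow b v).det = -((M.updateRow a v).updateRow b u).det := by
  have := Matrix.det_permute (Equiv.swap a b) ((M.updateRow a v).updateRow b u)
  rw [Equiv.Perm.sign_swap hab] at this
  simp only [Units.val_neg, Units.val_one, Int.cast_neg, Int.cast_one, neg_mul, one_mul] at this
  rw [← this]
  congr 1
  ext i j
  by_cases hb : i = b
  · subst hb; simp [Matrix.updateRow_ne hab]
  · by_cases ha : i = a
    · subst ha; simp [Matrix.updateRow_ne hab]
    · simp [Matrix.updateRow_ne ha, Matrix.updateRow_ne hb, Equiv.swap_apply_of_ne_of_ne ha hb]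

/-- Bordering by a unit vector in row `0` turns a minor into a full-size determinant. In that form
two modified rows can be exchanged, which is the source of the antisymmetry used in
`sum_deriv_minor`. -/
theorem det_updateRow_minor {k : ℕ} (Q : Matrix (Fin (k + 1)) (Fin (k + 1)) R) (a : Fin k)
    (b : Fin (k + 1)) (v : Fin (k + 1) → R) :
    (-1) ^ (b : ℕ) * ((Q.submatrix Fin.succ b.succAbove).updateRow a (v ∘ b.succAbove)).det =
      ((Q.updateRow a.succ v).updateRow 0 (Pi.single b 1)).det := by
  rw [← Matrix.adjugate_apply, Matrix.adjugate_fin_succ_eq_det_submatrix]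
  simp only [Fin.val_zero, zero_add]
  congr 2
  ext i j
  by_cases hi : i = a
  · subst hi; simp
  · simp [Matrix.updateRow_ne hi, Matrix.updateRow_ne (fun h => hi (Fin.succ_injective _ h))]

variable [Algebra ℂ R]

theorem leibniz_prod {ι : Type*} [DecidableEq ι] (d : Derivation ℂ R R) (s : Finset ι)
    (f : ι → R) :
    d (∏ i ∈ s, f i) = ∑ a ∈ s, ∏ i ∈ s, Function.update f a (d (f a)) i := by
  induction s using Finset.induction_on with
  | empty => simp
  | insert b s hb ih =>
    rw [Finset.prod_insert hb, Derivation.leibniz, ih, Finset.sum_insert hb, Finset.prod_insert hb,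
      Function.update_self, smul_eq_mul, smul_eq_mul, add_comm, Finset.mul_sum]
    congr 1
    · rw [mul_comm]
      congr 1
      refine Finset.prod_congr rfl fun i hi => ?_
      rw [Function.update_of_ne (by rintro rfl; exact hb hi)]
    · refine Finset.sum_congr rfl fun a ha => ?_
      rw [Finset.prod_insert hb, Function.update_of_ne (by rintro rfl; exact hb ha)]

/-- The derivative of a determinant, row by row. -/
theorem leibniz_det {ι : Type*} [DecidableEq ι] [Fintype ι] (d : Derivation ℂ R R)
    (N : Matrix ι ι R) :
    d N.det = ∑ a, (N.updateRow a fun b => d (N a b)).det := by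
  have h : ∀ M : Matrix ι ι R, M.det = ∑ σ : Equiv.Perm ι, Equiv.Perm.sign σ • ∏ i, M i (σ i) :=
    fun M => by rw [← Matrix.det_transpose, Matrix.det_apply]; rfl
  simp_rw [h, map_sum]
  rw [Finset.sum_comm]
  refine Finset.sum_congr rfl fun σ _ => ?_
  rw [← Finset.smul_sum]
  have h2 : ∀ r : R, d (Equiv.Perm.sign σ • r) = Equiv.Perm.sign σ • d r := fun r => by
    rcases Int.units_eq_one_or (Equiv.Perm.sign σ) with h | h <;> simp [h]
  rw [h2, leibniz_prod]
  congr 1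
  refine Finset.sum_congr rfl fun a _ => Finset.prod_congr rfl fun i _ => ?_
  by_cases hi : i = a
  · subst hi; simp
  · simp [hi]

theorem sum_symm_mul_antisymm {ι : Type*} [Fintype ι] (H X : ι → ι → R)
    (hH : ∀ i j, H i j = H j i) (hX : ∀ i j, X i j = -X j i) : ∑ i, ∑ j, H i j * X i j = 0 := by
  have h : ∑ i, ∑ j, H i j * X i j = -∑ i, ∑ j, H i j * X i j := by
    conv_lhs => rw [Finset.sum_comm]
    rw [← Finset.sum_neg_distrib]
    refine Finset.sum_congr rfl fun i _ => ?_
    rw [← Finset.sum_neg_distrib]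
    refine Finset.sum_congr rfl fun j _ => ?_
    rw [hH j i, hX j i, mul_neg]
  generalize ∑ i, ∑ j, H i j * X i j = x at h
  have h2 : (2 : ℂ) • x = 0 := by rw [two_smul]; nth_rewrite 2 [h]; simp
  simpa using congrArg (fun y => (2⁻¹ : ℂ) • y) h2

/-- The row expansion that drives the Cayley identity for symmetric matrices: here `G` plays the
role of the inverse of a symmetric matrix of indeterminates, and `δ i j` that of the derivative with
respect to its `(i, j)` entry. -/
theorem sum_deriv_minor {L k : ℕ} (G : Matrix (Fin L) (Fin L) R) (hG : ∀ i j, G i j = G j i)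
    (δ : Fin L → Fin L → Derivation ℂ R R)
    (hδ : ∀ i j k l, δ i j (G k l) = -(2⁻¹ : ℂ) • (G k i * G j l + G k j * G i l))
    (i j : Fin (k + 1) → Fin L) :
    ∑ b : Fin (k + 1), (-1) ^ (b : ℕ) *
        δ (i 0) (j b) (G.submatrix (i ∘ Fin.succ) (j ∘ b.succAbove)).det =
      ((k : ℂ) / 2) • (G.submatrix i j).det := by
  set Q := G.submatrix i j with hQ
  have hsub : ∀ b : Fin (k + 1), G.submatrix (i ∘ Fin.succ) (j ∘ b.succAbove) =
      Q.submatrix Fin.succ b.succAbove := fun b => rfl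
  -- Differentiating row `a` of the minor gives two rows: one along row `j b` of `G`, and one along
  -- row `0` of `Q`. For the second, exchanging rows `0` and `a.succ` produces a cofactor of row
  -- `a.succ`, with a minus sign.
  have key : ∀ (b : Fin (k + 1)) (a : Fin k),
      (-1) ^ (b : ℕ) * ((Q.submatrix Fin.succ b.succAbove).updateRow a fun c =>
        δ (i 0) (j b) (Q.submatrix Fin.succ b.succAbove a c)).det =
      -(2⁻¹ : ℂ) • (G (i a.succ) (i 0) *
          ∑ c, G (j b) (j c) *
            ((Q.updateRow a.succ (Pi.single c 1)).updateRow 0 (Pi.single b 1)).det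
        - Q a.succ b * Q.adjugate b a.succ) := by
    intro b a
    have h1 : (fun c => δ (i 0) (j b) (Q.submatrix Fin.succ b.succAbove a c)) =
        (algebraMap ℂ R (-(2⁻¹ : ℂ))) • ((G (i a.succ) (i 0)) •
          ((fun c => G (j b) (j c)) ∘ b.succAbove) + (Q a.succ b) • (Q 0 ∘ b.succAbove)) := by
      ext c
      simp [hQ, hδ, Algebra.smul_def]
    rw [h1, Matrix.det_updateRow_smul, Matrix.det_updateRow_add, Matrix.det_updateRow_smul,
      Matrix.det_updateRow_smul, mul_left_comm, mul_add, mul_left_comm, det_updateRow_minor,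
      mul_left_comm, det_updateRow_minor, ← Algebra.smul_def, sub_eq_add_neg, ← mul_neg,
      Matrix.adjugate_apply]
    congr 4
    · rw [Matrix.updateRow_comm _ (Fin.succ_ne_zero a), det_updateRow_eq_sum]
      refine Finset.sum_congr rfl fun c _ => ?_
      rw [Matrix.updateRow_comm _ (Fin.succ_ne_zero a)]
    · rw [det_swap_rows _ (Fin.succ_ne_zero a), Matrix.updateRow_comm _ (Fin.succ_ne_zero a)]
      congr 3
      exact Matrix.updateRow_eq_self _ _
  -- The first kind of term cancels in the sum over `b`: `G` is symmetric, and the doubly bordered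
  -- determinant is antisymmetric in `b` and `c`. The second kind is a Laplace expansion, so each of
  -- the `k` rows contributes half of `det Q`.
  have h2 : ∀ a : Fin k, ∑ b, ∑ c, G (j b) (j c) *
      ((Q.updateRow a.succ (Pi.single c 1)).updateRow 0 (Pi.single b 1)).det = 0 := fun a =>
    sum_symm_mul_antisymm _ _ (fun b c => hG _ _) fun b c => det_swap_rows _ (Fin.succ_ne_zero a) _ _
  simp_rw [hsub, leibniz_det, Finset.mul_sum]
  rw [Finset.sum_comm]
  simp_rw [key]
  have h3 : ∀ a : Fin k, ∑ b, Q a.succ b * Q.adjugate b a.succ = Q.det := fun a =>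
    (Matrix.det_eq_sum_mul_adjugate_row Q a.succ).symm
  simp_rw [← Finset.smul_sum, Finset.sum_sub_distrib, ← Finset.mul_sum, h2, h3]
  simp only [mul_zero, Finset.sum_const_zero, Finset.sum_const, Finset.card_univ, Fintype.card_fin,
    zero_sub, smul_neg, neg_smul, neg_neg]
  rw [← Nat.cast_smul_eq_nsmul ℂ, smul_smul]
  congr 1
  ring

end Algebra

end FeynmanIntegral

/-! ### The Baikov polynomial as a differential operator on the kernel -/

namespace FeynmanIntegral

theorem map_mul_derivation {R : Type*} [CommRing R] [Algebra ℂ R] (δ : Derivation ℂ R R)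
    {l m n : Type*} [Fintype m] (X : Matrix l m R) (Y : Matrix m n R) :
    (X * Y).map δ = X.map δ * Y + X * Y.map δ := by
  ext i j
  simp [Matrix.mul_apply, ← Finset.sum_add_distrib, mul_comm, add_comm]

theorem mul_single_mul_apply {L : ℕ} {R : Type*} [CommRing R] (X : Matrix (Fin L) (Fin L) R) {m : Type*} [Fintype m]
    [DecidableEq m] (Y : Matrix m (Fin L) R) (i : Fin L) (r : m) (k l : Fin L) :
    (X * Matrix.single i r (1 : R) * Y) k l = X k i * Y r l := by
  simp [Matrix.mul_apply, Matrix.single_apply, ite_and]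

namespace CompleteFamily

variable {L n p : ℕ} (F : CompleteFamily L n p)

/-- The coefficients of the inverse of `dotMap`. -/
noncomputable def dotCoeff (e : DotIdx L n) (a : Fin p) : ℝ :=
  (LinearEquiv.ofBijective (dotMap F.α F.β) F.complete).symm (Pi.single a 1) e

theorem sum_dotCoeff_mul_dotMap (e : DotIdx L n) (y : DotIdx L n → ℝ) :
    ∑ a, F.dotCoeff e a * dotMap F.α F.β y a = y e := by
  set T := LinearEquiv.ofBijective (dotMap F.α F.β) F.complete with hT
  have h : T.symm (∑ a, dotMap F.α F.β y a • Pi.single a (1 : ℝ)) = y := by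
    rw [T.symm_apply_eq]
    ext b
    simp [hT, Pi.single_apply]
  conv_rhs => rw [← h]
  simp [map_sum, dotCoeff, hT, mul_comm]

/-- The dot products of the symmetrised product of the `k`-th and the `l`-th loop momentum. -/
noncomputable def symmSingle {L n : ℕ} (k l : Fin L) : DotIdx L n → ℝ :=
  Sum.elim (Sym2.lift ⟨fun i j => ((if i = k ∧ j = l then 1 else 0) +
    (if i = l ∧ j = k then 1 else 0)) / 2, fun i j => by
      simp only [and_comm, add_comm]⟩) 0

theorem dotMap_symmSingle (k l : Fin L) (a : Fin p) :
    dotMap F.α F.β (symmSingle k l) a = F.α a k * F.α a l := by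
  simp [dotMap, symmSingle, mul_div_assoc', mul_add, ← Finset.sum_div, Finset.sum_add_distrib,
    ite_and]
  ring

/-- The products `α a k * α a l` and `α a k * β a s` are the coefficients of `s_a` in the entries of
`A` and `B`, and also the images under `dotMap` of symmetrised unit vectors. Inverting `dotMap`
therefore yields this and the next two duality relations. -/
theorem sum_dotCoeff_inl (i j k l : Fin L) :
    ∑ a, F.dotCoeff (Sum.inl s(i, j)) a * (F.α a k * F.α a l) =
      ((if i = k ∧ j = l then 1 else 0) + (if i = l ∧ j = k then 1 else 0)) / 2 := by
  have h := F.sum_dotCoeff_mul_dotMap (Sum.inl s(i, j)) (symmSingle k l)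
  simp only [dotMap_symmSingle] at h
  simpa [symmSingle] using h

theorem sum_dotCoeff_inr (i k l : Fin L) (r : Fin n) :
    ∑ a, F.dotCoeff (Sum.inr (i, r)) a * (F.α a k * F.α a l) = 0 := by
  have h := F.sum_dotCoeff_mul_dotMap (Sum.inr (i, r)) (symmSingle k l)
  simp only [dotMap_symmSingle] at h
  simpa [symmSingle] using h

theorem sum_dotCoeff_ext (e : DotIdx L n) (k : Fin L) (s : Fin n) :
    ∑ a, F.dotCoeff e a * (F.α a k * F.β a s) = if e = Sum.inr (k, s) then 2⁻¹ else 0 := by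
  let y : DotIdx L n → ℝ := fun e => if e = Sum.inr (k, s) then 2⁻¹ else 0
  have h := F.sum_dotCoeff_mul_dotMap e y
  have hy : ∀ a, dotMap F.α F.β y a = F.α a k * F.β a s := by
    intro a
    simp [dotMap, y, ite_and]
    ring
  simpa only [hy] using h

end CompleteFamily

/-- A commutative differential algebra that contains the Schwinger parameters `x`, the inverse `G`
of the matrix of the quadratic form, and the kernel `E = 𝒰 ^ w * exp (-i ℱ / 𝒰)`. -/
structure KernelModel {L n p : ℕ} (F : CompleteFamily L n p) (S : Matrix (Fin n) (Fin n) ℝ)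
    (M : Fin p → ℂ) (w : ℂ) (R : Type*) [CommRing R] [Algebra ℂ R] where
  d : Fin p → Derivation ℂ R R
  d_comm : ∀ a b f, d a (d b f) = d b (d a f)
  x : Fin p → R
  d_x : ∀ a b, d a (x b) = if a = b then 1 else 0
  A : Matrix (Fin L) (Fin L) R
  A_apply : ∀ i j, A i j = ∑ a, (F.α a i * F.α a j : ℂ) • x a
  B : Matrix (Fin L) (Fin n) R
  B_apply : ∀ i r, B i r = ∑ a, (F.α a i * F.β a r : ℂ) • x a
  G : Matrix (Fin L) (Fin L) R
  A_mul_G : A * G = 1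
  E : R
  d_E : ∀ a, d a E = E * (w • (G.det * d a A.det) - Complex.I • d a
    ((∑ b, (M b - F.extSq S b) • x b) +
      (G * (B * S.map (fun r => algebraMap ℂ R r) * B.transpose)).trace))

namespace KernelModel

variable {L n p : ℕ} {F : CompleteFamily L n p} {S : Matrix (Fin n) (Fin n) ℝ}
  {M : Fin p → ℂ} {w : ℂ} {R : Type*} [CommRing R] [Algebra ℂ R] (K : KernelModel F S M w R)

/-- The representation of polynomials by differential operators, `X a ↦ i * ∂ / ∂ x a`. -/
noncomputable def op : MvPolynomial (Fin p) ℂ →ₐ[ℂ] Module.End ℂ R :=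
  evalCommuting (fun a => Complex.I • (K.d a : R →ₗ[ℂ] R)) fun a b => by
    ext f
    simp [K.d_comm a b]

theorem op_X (a : Fin p) (f : R) : K.op (MvPolynomial.X a) f = Complex.I • K.d a f := by
  simp [op, evalCommuting_X]

/-- The external Gram matrix. -/
def ext (_ : KernelModel F S M w R) : Matrix (Fin n) (Fin n) R :=
  S.map fun r => algebraMap ℂ R r

/-- The trace part of the exponent of the kernel. -/
def tau : R := (K.G * (K.B * K.ext * K.B.transpose)).trace

/-- The derivative with respect to the coefficient of a dot product. -/
noncomputable def delta (e : DotIdx L n) : Derivation ℂ R R :=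
  ∑ a, (F.dotCoeff e a : ℂ) • K.d a

theorem delta_apply (e : DotIdx L n) (f : R) :
    K.delta e f = ∑ a, (F.dotCoeff e a : ℂ) • K.d a f := by
  rw [delta, ← Derivation.coeFnAddMonoidHom_apply, map_sum, Finset.sum_apply]; rfl

theorem op_dotPoly (e : DotIdx L n) (f : R) :
    K.op (F.dotPoly S M e) f =
      (∑ a, (F.dotCoeff e a : ℂ) * (M a - F.extSq S a)) • f - Complex.I • K.delta e f := by
  simp only [CompleteFamily.dotPoly, map_sum, map_mul, map_sub, LinearMap.sum_apply,
    Module.End.mul_apply, LinearMap.sub_apply, op_X, K.delta_apply, Finset.sum_smul,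
    ← MvPolynomial.algebraMap_eq, AlgHom.commutes, Module.algebraMap_end_apply, Finset.smul_sum,
    ← Finset.sum_sub_distrib]
  refine Finset.sum_congr rfl fun a _ => ?_
  change (F.dotCoeff e a : ℂ) • M a • f - (F.dotCoeff e a : ℂ) • (F.extSq S a : ℂ) • f -
    (F.dotCoeff e a : ℂ) • _ = _
  module

theorem A_symm : K.A.transpose = K.A := by
  ext i j
  simp [K.A_apply, mul_comm]

theorem G_mul_A : K.G * K.A = 1 := mul_eq_one_comm.mp K.A_mul_G

theorem G_symm : K.G.transpose = K.G := by
  have h : K.G.transpose * K.A = 1 := by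
    conv_lhs => rw [← K.A_symm]
    rw [← Matrix.transpose_mul, K.A_mul_G, Matrix.transpose_one]
  calc K.G.transpose = K.G.transpose * (K.A * K.G) := by rw [K.A_mul_G, mul_one]
    _ = K.G := by rw [← mul_assoc, h, one_mul]

theorem det_A_mul_det_G : K.A.det * K.G.det = 1 := by
  rw [← Matrix.det_mul, K.A_mul_G, Matrix.det_one]

theorem map_G (δ : Derivation ℂ R R) : K.G.map δ = -(K.G * K.A.map δ * K.G) := by
  have h := map_mul_derivation δ K.A K.G
  rw [K.A_mul_G] at h
  have h0 : (1 : Matrix (Fin L) (Fin L) R).map δ = 0 := by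
    ext i j
    by_cases hij : i = j <;> simp [hij]
  rw [h0] at h
  calc K.G.map δ = K.G * (K.A * K.G.map δ) := by rw [← mul_assoc, K.G_mul_A, one_mul]
    _ = _ := by rw [eq_neg_of_add_eq_zero_right h.symm, mul_neg, mul_assoc]

/-- Jacobi's formula, from the row-by-row Leibniz rule and `adj A = det A • G`; the factor `G.det`
plays the role of `1 / det A`. -/
theorem deriv_det (δ : Derivation ℂ R R) : K.G.det * δ K.A.det = (K.G * K.A.map δ).trace := by
  have h : K.A.adjugate = K.A.det • K.G := by
    calc K.A.adjugate = K.A.adjugate * (K.A * K.G) := by rw [K.A_mul_G, mul_one]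
      _ = _ := by rw [← mul_assoc, Matrix.adjugate_mul, smul_mul_assoc, one_mul]
  rw [leibniz_det, Matrix.trace_mul_comm, Matrix.trace, Finset.mul_sum]
  refine Finset.sum_congr rfl fun a _ => ?_
  rw [det_updateRow_eq_sum, Matrix.diag_apply, Matrix.mul_apply, Finset.mul_sum]
  refine Finset.sum_congr rfl fun c _ => ?_
  rw [← Matrix.adjugate_apply, h, Matrix.smul_apply, Matrix.map_apply, smul_eq_mul]
  linear_combination (δ (K.A a c) * K.G c a) * K.det_A_mul_det_G

theorem delta_sum_smul_x (e : DotIdx L n) (c : Fin p → ℂ) :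
    K.delta e (∑ a, c a • K.x a) = algebraMap ℂ R (∑ a, (F.dotCoeff e a : ℂ) * c a) := by
  have h : ∀ a, K.d a (∑ b, c b • K.x b) = c a • 1 := fun a => by simp [K.d_x]
  simp only [delta_apply, h, Algebra.algebraMap_eq_smul_one, Finset.sum_smul, smul_smul]

/-- With the three lemmas that follow: `delta` is differentiation in a single entry of `A` or `B`.
The weight `1/2` reflects that `A` is symmetric and that mixed products occur twice in the square of
a momentum. -/
theorem map_A_inl (i j : Fin L) : K.A.map (K.delta (Sum.inl s(i, j))) =
    (2⁻¹ : ℂ) • (Matrix.single i j 1 + Matrix.single j i 1) := by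
  ext k l
  rw [Matrix.map_apply, K.A_apply, delta_sum_smul_x]
  have h := congrArg (fun r : ℝ => (r : ℂ)) (F.sum_dotCoeff_inl i j k l)
  push_cast at h
  rw [h]
  simp only [Matrix.smul_apply, Matrix.add_apply, Matrix.single_apply,
    Algebra.algebraMap_eq_smul_one, and_comm (a := j = k)]
  split_ifs <;> (simp [← add_smul]; try norm_num)

theorem map_A_inr (i : Fin L) (r : Fin n) : K.A.map (K.delta (Sum.inr (i, r))) = 0 := by
  ext k l
  rw [Matrix.map_apply, K.A_apply, delta_sum_smul_x]
  have h := congrArg (fun r : ℝ => (r : ℂ)) (F.sum_dotCoeff_inr i k l r)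
  push_cast at h
  rw [h]
  simp

theorem map_B_inl (s : Sym2 (Fin L)) : K.B.map (K.delta (Sum.inl s)) = 0 := by
  ext k l
  rw [Matrix.map_apply, K.B_apply, delta_sum_smul_x]
  have h := congrArg (fun r : ℝ => (r : ℂ)) (F.sum_dotCoeff_ext (Sum.inl s) k l)
  push_cast at h
  rw [h]
  simp

theorem map_B_inr (i : Fin L) (r : Fin n) : K.B.map (K.delta (Sum.inr (i, r))) =
    (2⁻¹ : ℂ) • Matrix.single i r 1 := by
  ext k l
  rw [Matrix.map_apply, K.B_apply, delta_sum_smul_x]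
  have h := congrArg (fun r : ℝ => (r : ℂ)) (F.sum_dotCoeff_ext (Sum.inr (i, r)) k l)
  push_cast at h
  rw [h]
  simp only [Matrix.smul_apply, Matrix.single_apply, Algebra.algebraMap_eq_smul_one, Sum.inr.injEq,
    Prod.mk.injEq]
  split_ifs <;> simp

theorem map_ext (δ : Derivation ℂ R R) : K.ext.map δ = 0 := by
  ext i j
  simp [ext]

theorem delta_G (i j k l : Fin L) : K.delta (Sum.inl s(i, j)) (K.G k l) =
    -(2⁻¹ : ℂ) • (K.G k i * K.G j l + K.G k j * K.G i l) := by
  have h := congrFun (congrFun (K.map_G (K.delta (Sum.inl s(i, j)))) k) l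
  rw [Matrix.map_apply] at h
  rw [h, K.map_A_inl, mul_smul_comm, smul_mul_assoc, mul_add, add_mul, Matrix.neg_apply,
    Matrix.smul_apply, Matrix.add_apply, mul_single_mul_apply, mul_single_mul_apply, neg_smul]

theorem G_apply_comm (i j : Fin L) : K.G i j = K.G j i := congrFun (congrFun K.G_symm j) i

theorem delta_inr_G (i k l : Fin L) (r : Fin n) : K.delta (Sum.inr (i, r)) (K.G k l) = 0 := by
  have h := congrFun (congrFun (K.map_G (K.delta (Sum.inr (i, r)))) k) l
  rw [Matrix.map_apply] at h
  rw [h, K.map_A_inr]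
  simp

theorem det_G_mul_delta_inl (i j : Fin L) :
    K.G.det * K.delta (Sum.inl s(i, j)) K.A.det = K.G i j := by
  rw [deriv_det, map_A_inl, mul_smul_comm, Matrix.trace_smul, mul_add, Matrix.trace_add,
    Matrix.trace_mul_single, Matrix.trace_mul_single]
  simp only [K.G_apply_comm j i, smul_add, MulOpposite.op_one, one_smul]
  module

theorem det_G_mul_delta_inr (i : Fin L) (r : Fin n) :
    K.G.det * K.delta (Sum.inr (i, r)) K.A.det = 0 := by
  rw [deriv_det, map_A_inr]
  simp

/-- The matrix `A⁻¹ B S`. -/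
def V : Matrix (Fin L) (Fin n) R := K.G * K.B * K.ext

/-- The matrix `A⁻¹ B S Bᵀ A⁻¹`. -/
def W : Matrix (Fin L) (Fin L) R := K.G * (K.B * K.ext * K.B.transpose) * K.G

theorem delta_inr_V (i j : Fin L) (r s : Fin n) :
    K.delta (Sum.inr (i, r)) (K.V j s) = (2⁻¹ : ℂ) • (K.G i j * K.ext r s) := by
  have h : K.V.map (K.delta (Sum.inr (i, r))) =
      K.G * ((2⁻¹ : ℂ) • Matrix.single i r (1 : R)) * K.ext := by
    rw [V, map_mul_derivation, map_mul_derivation, K.map_ext, K.map_G, K.map_A_inr, K.map_B_inr]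
    simp only [mul_zero, zero_mul, neg_zero, Matrix.zero_mul, zero_add, Matrix.mul_zero, add_zero]
  have h2 := congrFun (congrFun h j) s
  rw [Matrix.map_apply] at h2
  rw [h2]
  simp [Matrix.mul_apply, Matrix.single_apply, ite_and, K.G_apply_comm j i]

theorem delta_E (e : DotIdx L n) : K.delta e K.E = K.E * (w • (K.G.det * K.delta e K.A.det)
    - Complex.I • (algebraMap ℂ R (∑ a, (F.dotCoeff e a : ℂ) * (M a - F.extSq S a)) +
      K.delta e K.tau)) := by
  have h : ∀ a, K.d a K.E = K.E * (w • (K.G.det * K.d a K.A.det) - Complex.I • K.d a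
    ((∑ b, (M b - F.extSq S b) • K.x b) + K.tau)) := K.d_E
  rw [← K.delta_sum_smul_x, ← map_add]
  simp only [delta_apply, h]
  simp only [Finset.mul_sum, Finset.smul_sum, ← Finset.sum_sub_distrib]
  refine Finset.sum_congr rfl fun a _ => ?_
  simp only [Algebra.smul_def]
  ring

/-- The derivative of the linear part of the exponent cancels the constant term of `dotPoly` because
`i² = -1`. Masses and purely external squares thus disappear; only the power of `det A` and the
trace `tau` act. -/
theorem op_dotPoly_E_mul (e : DotIdx L n) (g : R) :
    K.op (F.dotPoly S M e) (K.E * g) = -Complex.I • (K.E * (K.delta e g +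
      w • (K.G.det * K.delta e K.A.det * g) - Complex.I • (K.delta e K.tau * g))) := by
  have hI : algebraMap ℂ R Complex.I * algebraMap ℂ R Complex.I = -1 := by
    rw [← map_mul, Complex.I_mul_I, map_neg, map_one]
  rw [op_dotPoly, Derivation.leibniz, K.delta_E]
  simp only [Algebra.smul_def, map_neg]
  linear_combination (K.E * g * algebraMap ℂ R (∑ a, (F.dotCoeff e a : ℂ) * (M a - F.extSq S a))) * hI

section

variable (hS : S.IsSymm)
include hS

theorem ext_symm : K.ext.transpose = K.ext := by
  ext i j
  simp [ext, hS.apply]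

theorem W_apply_comm (i j : Fin L) : K.W i j = K.W j i := by
  have : K.W.transpose = K.W := by
    simp [W, Matrix.transpose_mul, K.G_symm, K.ext_symm hS, Matrix.mul_assoc]
  exact congrFun (congrFun this j) i

theorem delta_inl_tau (i j : Fin L) : K.delta (Sum.inl s(i, j)) K.tau = -K.W i j := by
  have h1 : ∀ X : Matrix (Fin L) (Fin L) R, K.delta (Sum.inl s(i, j)) X.trace =
      (X.map (K.delta (Sum.inl s(i, j)))).trace := fun X => by simp [Matrix.trace]
  have h2 : (K.B.transpose).map (K.delta (Sum.inl s(i, j))) = 0 := by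
    rw [Matrix.transpose_map, K.map_B_inl, Matrix.transpose_zero]
  rw [tau, h1, map_mul_derivation, map_mul_derivation, map_mul_derivation, K.map_B_inl, K.map_ext,
    h2, K.map_G, K.map_A_inl]
  simp only [mul_zero, add_zero, Matrix.zero_mul, Matrix.mul_zero]
  rw [neg_mul, Matrix.trace_neg, Matrix.trace_mul_comm, ← Matrix.mul_assoc, ← Matrix.mul_assoc,
    Matrix.trace_mul_comm, ← Matrix.mul_assoc, ← Matrix.mul_assoc, ← W, mul_smul_comm, Matrix.trace_smul, mul_add, Matrix.trace_add,
    Matrix.trace_mul_single, Matrix.trace_mul_single]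
  simp only [K.W_apply_comm hS j i, smul_add, MulOpposite.op_one, one_smul]
  module

theorem delta_inr_tau (i : Fin L) (r : Fin n) : K.delta (Sum.inr (i, r)) K.tau = K.V i r := by
  have h1 : ∀ X : Matrix (Fin L) (Fin L) R, K.delta (Sum.inr (i, r)) X.trace =
      (X.map (K.delta (Sum.inr (i, r)))).trace := fun X => by simp [Matrix.trace]
  rw [tau, h1, map_mul_derivation, map_mul_derivation, map_mul_derivation, K.map_ext,
    K.map_G, K.map_A_inr, Matrix.transpose_map, K.map_B_inr]
  simp only [zero_mul, mul_zero, add_zero, Matrix.mul_zero, neg_zero, zero_add]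
  -- `B` occurs twice in `tau`; by transposition both occurrences contribute the same, and the two
  -- halves add up to `V`.
  have h3 : (K.G * ((2⁻¹ : ℂ) • Matrix.single i r (1 : R) * K.ext * K.B.transpose)).trace =
      (K.G * (K.B * K.ext * ((2⁻¹ : ℂ) • Matrix.single i r (1 : R)).transpose)).trace := by
    rw [← Matrix.trace_transpose]
    simp only [Matrix.transpose_mul, K.G_symm, K.ext_symm hS, Matrix.transpose_transpose]
    rw [Matrix.trace_mul_comm]
    simp only [Matrix.mul_assoc]
  rw [mul_add, Matrix.trace_add, h3, ← Matrix.mul_assoc, ← Matrix.mul_assoc, ← V,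
    Matrix.transpose_smul, Matrix.transpose_single, Matrix.mul_smul, Matrix.trace_smul,
    Matrix.trace_mul_single]
  simp only [MulOpposite.op_one, one_smul]
  module

theorem op_dotPoly_inl (i j : Fin L) (g : R) :
    K.op (F.dotPoly S M (Sum.inl s(i, j))) (K.E * g) =
      -Complex.I • (K.E * (K.delta (Sum.inl s(i, j)) g + w • (K.G i j * g)
        + Complex.I • (K.W i j * g))) := by
  rw [K.op_dotPoly_E_mul, K.det_G_mul_delta_inl, K.delta_inl_tau hS, neg_mul, smul_neg,
    sub_neg_eq_add]

theorem op_dotPoly_inr (i : Fin L) (r : Fin n) (g : R) :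
    K.op (F.dotPoly S M (Sum.inr (i, r))) (K.E * g) =
      -Complex.I • (K.E * (K.delta (Sum.inr (i, r)) g - Complex.I • (K.V i r * g))) := by
  rw [K.op_dotPoly_E_mul, K.det_G_mul_delta_inr, K.delta_inr_tau hS, zero_mul, smul_zero,
    add_zero]

end

variable (F S M) in
/-- The Schur complement of the external Gram matrix in the full Gram matrix. -/
noncomputable def schur : Matrix (Fin L) (Fin L) (MvPolynomial (Fin p) ℂ) :=
  (Matrix.of fun i j : Fin L => F.dotPoly S M (Sum.inl s(i, j))) -
    (Matrix.of fun (i : Fin L) (r : Fin n) => F.dotPoly S M (Sum.inr (i, r))) *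
      S⁻¹.map (fun x : ℝ => (MvPolynomial.C (x : ℂ) : MvPolynomial (Fin p) ℂ)) *
    Matrix.of fun (r : Fin n) (i : Fin L) => F.dotPoly S M (Sum.inr (i, r))

variable (F S M) in
-- The external block of the Gram matrix is constant and invertible, so the block determinant
-- formula splits off `det S`.
theorem baikovPoly_eq (hG : S.det ≠ 0) :
    F.baikovPoly S M = MvPolynomial.C (S.det : ℂ) * (schur F S M).det := by
  let φ : ℝ →+* MvPolynomial (Fin p) ℂ := MvPolynomial.C.comp Complex.ofRealHom
  have h : S⁻¹.map φ * S.map φ = 1 := by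
    rw [← Matrix.map_mul, Matrix.nonsing_inv_mul _ (isUnit_iff_ne_zero.mpr hG), Matrix.map_one]
    · exact map_zero φ
    · exact map_one φ
  let _ : Invertible (S.map φ) := ⟨S⁻¹.map φ, h, mul_eq_one_comm.mp h⟩
  have h2 := Matrix.det_fromBlocks₂₂ (Matrix.of fun i j : Fin L => F.dotPoly S M (Sum.inl s(i, j)))
    (Matrix.of fun (i : Fin L) (r : Fin n) => F.dotPoly S M (Sum.inr (i, r)))
    (Matrix.of fun (r : Fin n) (i : Fin L) => F.dotPoly S M (Sum.inr (i, r))) (S.map φ)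
  have h3 : (S.map φ).det = MvPolynomial.C (S.det : ℂ) := (RingHom.map_det φ S).symm
  rw [h3] at h2
  rw [schur]
  exact h2

theorem sum_inv_smul_ext (hS : S.IsSymm) (hG : S.det ≠ 0) :
    ∑ r, ∑ s, ((S⁻¹ r s : ℝ) : ℂ) • K.ext r s = (n : ℂ) • (1 : R) := by
  have h : ∑ r, ∑ s, S⁻¹ r s * S r s = n := by
    have h1 : (S⁻¹ * S).trace = n := by
      rw [Matrix.nonsing_inv_mul _ (isUnit_iff_ne_zero.mpr hG)]
      simp
    simpa [Matrix.trace, Matrix.mul_apply, hS.apply] using h1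
  have h2 := congrArg (fun r : ℝ => (r : ℂ)) h
  push_cast at h2
  simp only [← h2, ext, Matrix.map_apply, Finset.sum_smul, Algebra.algebraMap_eq_smul_one,
    smul_smul]

theorem sum_V_mul_V (hS : S.IsSymm) (hG : S.det ≠ 0) (i j : Fin L) :
    ∑ r, ∑ s, ((S⁻¹ r s : ℝ) : ℂ) • (K.V i r * K.V j s) = K.W i j := by
  let φ : ℝ →+* R := (algebraMap ℂ R).comp Complex.ofRealHom
  have h : K.ext * S⁻¹.map φ = 1 := by
    change S.map φ * S⁻¹.map φ = 1
    rw [← Matrix.map_mul, Matrix.mul_nonsing_inv _ (isUnit_iff_ne_zero.mpr hG), Matrix.map_one]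
    · exact map_zero φ
    · exact map_one φ
  have h2 : K.W = K.V * S⁻¹.map φ * K.V.transpose := by
    simp only [W, V, Matrix.transpose_mul, K.G_symm, K.ext_symm hS]
    rw [Matrix.mul_assoc (K.G * K.B) K.ext, h, Matrix.mul_one]
    simp only [Matrix.mul_assoc]
  rw [h2, Finset.sum_comm, Matrix.mul_apply]
  simp only [Matrix.mul_apply, Finset.sum_mul, Algebra.smul_def, Matrix.transpose_apply,
    Matrix.map_apply]
  refine Finset.sum_congr rfl fun s _ => Finset.sum_congr rfl fun r _ => ?_
  change _ = K.V i r * algebraMap ℂ R ((S⁻¹ r s : ℝ) : ℂ) * K.V j s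
  ring

/-- Two mixed operators applied in succession multiply by `V i r * V j s` and also differentiate `V
j s`. Contracted with `S⁻¹`, the products give `W i j`, which cancels the contribution of `tau` to
the first block, and the derivatives give `n/2` copies of `G i j`, by `tr (S⁻¹ S) = n`. The
condition on `g` means that `g` does not vary with `B`. -/
theorem op_schur (hS : S.IsSymm) (hG : S.det ≠ 0) (i j : Fin L) (g : R)
    (hg : ∀ k r, K.delta (Sum.inr (k, r)) g = 0) :
    K.op (schur F S M i j) (K.E * g) = -Complex.I • (K.E *
      (K.delta (Sum.inl s(i, j)) g + (w + n / 2) • (K.G i j * g))) := by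
  have hI : algebraMap ℂ R Complex.I * algebraMap ℂ R Complex.I = -1 := by
    rw [← map_mul, Complex.I_mul_I, map_neg, map_one]
  have h1 : ∀ r s, K.op (F.dotPoly S M (Sum.inr (i, r)) * MvPolynomial.C ((S⁻¹ r s : ℝ) : ℂ) *
      F.dotPoly S M (Sum.inr (j, s))) (K.E * g) =
      -Complex.I • (K.E * (-(2⁻¹ : ℂ) • (((S⁻¹ r s : ℝ) : ℂ) • K.ext r s) * (K.G i j * g) +
        Complex.I • (((S⁻¹ r s : ℝ) : ℂ) • (K.V i r * K.V j s) * g))) := by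
    intro r s
    have h2 : K.op (F.dotPoly S M (Sum.inr (j, s))) (K.E * g) = K.E * -(K.V j s * g) := by
      rw [K.op_dotPoly_inr hS, hg]
      simp only [Algebra.smul_def, map_neg]
      linear_combination (K.E * K.V j s * g) * hI
    rw [map_mul K.op, map_mul K.op, Module.End.mul_apply, Module.End.mul_apply, h2,
      ← MvPolynomial.algebraMap_eq, AlgHom.commutes, Module.algebraMap_end_apply, map_smul,
      K.op_dotPoly_inr hS, map_neg, Derivation.leibniz, hg, K.delta_inr_V]
    simp only [Algebra.smul_def, map_neg, Algebra.algebraMap_self, RingHom.id_apply]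
    ring
  have h3 : schur F S M i j = F.dotPoly S M (Sum.inl s(i, j)) - ∑ r, ∑ s,
      F.dotPoly S M (Sum.inr (i, r)) * MvPolynomial.C ((S⁻¹ r s : ℝ) : ℂ) *
      F.dotPoly S M (Sum.inr (j, s)) := by
    rw [Finset.sum_comm]
    simp [schur, Matrix.mul_apply, Finset.sum_mul]
  rw [h3, map_sub, LinearMap.sub_apply, K.op_dotPoly_inl hS]
  simp only [map_sum, LinearMap.sum_apply, h1]
  simp only [← Finset.smul_sum, ← Finset.mul_sum, Finset.sum_add_distrib, ← Finset.sum_mul,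
    K.sum_inv_smul_ext hS hG, K.sum_V_mul_V hS hG]
  simp only [Algebra.smul_def, map_neg, map_add, map_natCast, div_eq_mul_inv, map_mul]
  ring

theorem delta_inr_det (k : Fin L) (r : Fin n) {m : ℕ} (i j : Fin m → Fin L) :
    K.delta (Sum.inr (k, r)) (K.G.submatrix i j).det = 0 := by
  rw [leibniz_det]
  refine Finset.sum_eq_zero fun a _ => Matrix.det_eq_zero_of_row_eq_zero a fun b => ?_
  simp [K.delta_inr_G]

/-- The Cayley identity for the minors of the Schur complement. -/
theorem op_det_schur (hS : S.IsSymm) (hG : S.det ≠ 0) {m : ℕ} (i j : Fin m → Fin L) :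
    K.op ((schur F S M).submatrix i j).det K.E =
      ((-Complex.I) ^ m * ∏ t ∈ Finset.range m, (w + n / 2 + t / 2)) •
        (K.E * (K.G.submatrix i j).det) := by
  induction m with
  | zero => simp
  | succ m ih =>
    -- In the expansion along row `0` the complementary minor acts first. By induction it yields the
    -- kernel times a minor of `G`, which is free of `B`, so `op_schur` applies to the remaining
    -- entry.
    have h1 : ∀ b : Fin (m + 1), K.op ((-1) ^ (b : ℕ) * (schur F S M).submatrix i j 0 b *
        (((schur F S M).submatrix i j).submatrix Fin.succ b.succAbove).det) K.E =
        ((-Complex.I) ^ (m + 1) * ∏ t ∈ Finset.range m, (w + n / 2 + t / 2)) • (K.E *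
          ((-1) ^ (b : ℕ) * K.delta (Sum.inl s(i 0, j b))
              (K.G.submatrix (i ∘ Fin.succ) (j ∘ b.succAbove)).det +
            (w + n / 2) • ((-1) ^ (b : ℕ) * K.G.submatrix i j 0 b *
              ((K.G.submatrix i j).submatrix Fin.succ b.succAbove).det))) := by
      intro b
      have h2 : ∀ f : R, K.op ((-1) ^ (b : ℕ)) f = (-1) ^ (b : ℕ) * f := fun f => by
        rcases neg_one_pow_eq_or (MvPolynomial (Fin p) ℂ) (b : ℕ) with h | h <;>
        rcases Nat.even_or_odd (b : ℕ) with h' | h' <;>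
        simp [h'.neg_one_pow]
      rw [mul_assoc, map_mul K.op, map_mul K.op, Module.End.mul_apply, Module.End.mul_apply,
        Matrix.submatrix_submatrix, ih, map_smul, Matrix.submatrix_apply,
        K.op_schur hS hG _ _ _ fun k r => K.delta_inr_det k r _ _, h2, Matrix.submatrix_submatrix,
        Matrix.submatrix_apply, pow_succ]
      simp only [Algebra.smul_def, map_mul, map_neg]
      ring
    rw [Matrix.det_succ_row_zero, map_sum, LinearMap.sum_apply]
    simp only [h1]
    -- The derivative terms sum to `m/2` times the determinant and the undifferentiated ones to `w +
    -- n/2` times it: together they are the new factor of the product.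
    rw [← Finset.smul_sum, ← Finset.mul_sum, Finset.sum_add_distrib, ← Finset.smul_sum,
      ← Matrix.det_succ_row_zero, sum_deriv_minor K.G K.G_apply_comm
        (fun i j => K.delta (Sum.inl s(i, j))) K.delta_G, Finset.prod_range_succ, ← add_smul]
    simp only [Algebra.smul_def, map_mul, map_add]
    ring

/-- The factors are `-(D - n - t)/2`, which is the Pochhammer product in descending order. The last
factor on the left is thus the first on the right, whence `ascPochhammer_succ_left`. -/
theorem prod_range_eq_ascPochhammer (D : ℂ) (L n : ℕ) :
    ∏ t ∈ Finset.range L, (-D / 2 + n / 2 + t / 2 : ℂ) =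
      (-2⁻¹) ^ L * (ascPochhammer ℂ L).eval (D - ((L + n : ℕ) : ℂ) + 1) := by
  induction L with
  | zero => simp
  | succ L ih =>
    rw [Finset.prod_range_succ, ih, ascPochhammer_succ_left, Polynomial.eval_mul, Polynomial.eval_X,
      Polynomial.eval_comp, Polynomial.eval_add, Polynomial.eval_X, Polynomial.eval_one]
    have h : D - ((L + 1 + n : ℕ) : ℂ) + 1 + 1 = D - ((L + n : ℕ) : ℂ) + 1 := by push_cast; ring
    rw [h]
    push_cast
    ring

/-- The Baikov polynomial acts on the kernel as a raising operator for the dimension. -/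
theorem op_baikovPoly {D : ℂ} (K : KernelModel F S M (-D / 2) R) (hS : S.IsSymm)
    (hG : S.det ≠ 0) :
    K.op (F.baikovPoly S M) K.E = (S.det * (Complex.I / 2) ^ L *
      (ascPochhammer ℂ L).eval (D - ((L + n : ℕ) : ℂ) + 1) : ℂ) • (K.E * K.G.det) := by
  have h := K.op_det_schur hS hG (id : Fin L → Fin L) id
  rw [Matrix.submatrix_id_id, Matrix.submatrix_id_id, prod_range_eq_ascPochhammer, ← mul_assoc,
    ← mul_pow] at h
  rw [baikovPoly_eq F S M hG, map_mul K.op, Module.End.mul_apply, h, ← MvPolynomial.algebraMap_eq,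
    AlgHom.commutes, Module.algebraMap_end_apply, smul_smul, ← mul_assoc]
  congr 4
  ring

end KernelModel

end FeynmanIntegral

/-! ### Smooth functions on the orthant as a model of the kernel algebra -/

namespace FeynmanIntegral

open scoped ContDiff

theorem isOpen_orthant (p : ℕ) : IsOpen (orthant p) := by
  have : orthant p = ⋂ a, (fun s : Fin p → ℝ => s a) ⁻¹' Set.Ioi 0 := by
    ext s; simp [orthant]
  rw [this]
  exact isOpen_iInter_of_finite fun a => isOpen_Ioi.preimage (continuous_apply a)

/-- The extension by zero of a function on the orthant. -/
noncomputable def extendZero {p : ℕ} (f : orthant p → ℂ) : (Fin p → ℝ) → ℂ :=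
  Function.extend Subtype.val f 0

theorem extendZero_coe {p : ℕ} (f : orthant p → ℂ) (s : orthant p) : extendZero f s = f s :=
  Subtype.val_injective.extend_apply f 0 s

theorem eqOn_extendZero {p : ℕ} (f : orthant p → ℂ) (g : (Fin p → ℝ) → ℂ)
    (h : ∀ s : orthant p, f s = g s) : Set.EqOn (extendZero f) g (orthant p) :=
  fun s hs => (extendZero_coe f ⟨s, hs⟩).trans (h ⟨s, hs⟩)

theorem contDiffOn_extendZero {p : ℕ} (f : orthant p → ℂ) (g : (Fin p → ℝ) → ℂ)
    (h : ∀ s : orthant p, f s = g s) (hg : ContDiffOn ℝ ∞ g (orthant p)) :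
    ContDiffOn ℝ ∞ (extendZero f) (orthant p) :=
  hg.congr (eqOn_extendZero f g h)

/-- The algebra of smooth functions on the open orthant. -/
noncomputable def smoothAlgebra (p : ℕ) : Subalgebra ℂ (orthant p → ℂ) where
  carrier := {f | ContDiffOn ℝ ∞ (extendZero f) (orthant p)}
  mul_mem' {f g} hf hg := contDiffOn_extendZero _ (fun s => extendZero f s * extendZero g s)
    (fun s => by simp [extendZero_coe]) (ContDiffOn.mul hf hg)
  add_mem' {f g} hf hg := contDiffOn_extendZero _ (fun s => extendZero f s + extendZero g s)
    (fun s => by simp [extendZero_coe]) (ContDiffOn.add hf hg)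
  algebraMap_mem' c := contDiffOn_extendZero _ (fun _ => c) (fun _ => rfl) contDiffOn_const

namespace smoothAlgebra

variable {p : ℕ}

theorem ext' {f g : smoothAlgebra p} (h : ∀ s, f.1 s = g.1 s) : f = g := Subtype.ext (funext h)

/-- The evaluation at a point of the orthant. -/
noncomputable def eval (s : orthant p) : smoothAlgebra p →ₐ[ℂ] ℂ :=
  (Pi.evalAlgHom ℂ (fun _ : orthant p => ℂ) s).comp (smoothAlgebra p).val

theorem eval_ext {f g : smoothAlgebra p} (h : ∀ s, eval s f = eval s g) : f = g := ext' h

theorem differentiableAt (f : smoothAlgebra p) (s : orthant p) :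
    DifferentiableAt ℝ (extendZero f.1) s :=
  (f.2.contDiffAt ((isOpen_orthant p).mem_nhds s.2)).differentiableAt (by simp)

theorem fderiv_eq (f : orthant p → ℂ) (g : (Fin p → ℝ) → ℂ) (h : ∀ s : orthant p, f s = g s)
    (s : orthant p) : fderiv ℝ (extendZero f) s = fderiv ℝ g s :=
  ((eqOn_extendZero f g h).eventuallyEq_of_mem ((isOpen_orthant p).mem_nhds s.2)).fderiv_eq

/-- The partial derivative of a smooth function, as a function. -/
noncomputable def pdFun (a : Fin p) (f : smoothAlgebra p) : smoothAlgebra p :=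
  ⟨fun s => fderiv ℝ (extendZero f.1) s (Pi.single a 1),
    contDiffOn_extendZero _ (fun s => fderiv ℝ (extendZero f.1) s (Pi.single a 1)) (fun _ => rfl)
      ((f.2.fderiv_of_isOpen (isOpen_orthant p) (m := ∞) (by simp)).clm_apply contDiffOn_const)⟩

/-- The partial derivatives on the algebra of smooth functions. -/
noncomputable def pd (a : Fin p) : Derivation ℂ (smoothAlgebra p) (smoothAlgebra p) :=
  Derivation.mk'
    { toFun := pdFun a
      map_add' := fun f g => ext' fun s => by
        have h := fderiv_eq (f + g).1 (extendZero f.1 + extendZero g.1)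
          (fun s => by simp [extendZero_coe]) s
        rw [fderiv_add (smoothAlgebra.differentiableAt f s) (smoothAlgebra.differentiableAt g s)] at h
        exact congrArg (fun l => l (Pi.single a 1)) h
      map_smul' := fun c f => ext' fun s => by
        have h := fderiv_eq (c • f).1 (c • extendZero f.1) (fun s => by simp [extendZero_coe]) s
        rw [fderiv_const_smul (smoothAlgebra.differentiableAt f s)] at h
        exact congrArg (fun l => l (Pi.single a 1)) h }
    fun f g => ext' fun s => by
      have h := fderiv_eq (f * g).1 (extendZero f.1 * extendZero g.1)
        (fun s => by simp [extendZero_coe]) s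
      rw [fderiv_mul (smoothAlgebra.differentiableAt f s) (smoothAlgebra.differentiableAt g s), extendZero_coe,
        extendZero_coe] at h
      exact congrArg (fun l => l (Pi.single a 1)) h

theorem pd_apply (a : Fin p) (f : smoothAlgebra p) (s : orthant p) :
    eval s (pd a f) = fderiv ℝ (extendZero f.1) s (Pi.single a 1) := rfl

theorem pd_apply_eq (a : Fin p) (f : smoothAlgebra p) (g : (Fin p → ℝ) → ℂ)
    (h : ∀ s : orthant p, f.1 s = g s) (s : orthant p) :
    eval s (pd a f) = fderiv ℝ g s (Pi.single a 1) := by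
  rw [pd_apply, fderiv_eq _ _ h]

theorem hasDerivAt (a : Fin p) (f : smoothAlgebra p) (s : orthant p) :
    HasDerivAt (fun t => extendZero f.1 (Function.update s.1 a t)) (eval s (pd a f)) (s.1 a) := by
  have h1 : HasFDerivAt (extendZero f.1) (fderiv ℝ (extendZero f.1) s)
      (Function.update s.1 a (s.1 a)) := by
    rw [Function.update_eq_self]; exact (smoothAlgebra.differentiableAt f s).hasFDerivAt
  exact h1.comp_hasDerivAt (s.1 a) (hasDerivAt_update s.1 a (s.1 a))

theorem pd_comm (a b : Fin p) (f : smoothAlgebra p) : pd a (pd b f) = pd b (pd a f) := by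
  have h : ∀ (a b : Fin p) (s : orthant p), eval s (pd a (pd b f)) =
      fderiv ℝ (fderiv ℝ (extendZero f.1)) s (Pi.single a 1) (Pi.single b 1) := by
    intro a b s
    rw [pd_apply_eq a _ (fun s => fderiv ℝ (extendZero f.1) s (Pi.single b 1)) (fun _ => rfl)]
    have hd : DifferentiableAt ℝ (fderiv ℝ (extendZero f.1)) s :=
      ((f.2.fderiv_of_isOpen (isOpen_orthant p) (m := ∞) (by simp)).contDiffAt
        ((isOpen_orthant p).mem_nhds s.2)).differentiableAt (by simp)
    rw [fderiv_clm_apply hd (by fun_prop)]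
    simp
  refine eval_ext fun s => ?_
  rw [h, h]
  exact (f.2.contDiffAt ((isOpen_orthant p).mem_nhds s.2)).isSymmSndFDerivAt (by
    simp only [minSmoothness_of_isRCLikeNormedField]
    exact WithTop.coe_le_coe.mpr (le_top (a := (2 : ℕ∞)))) _ _

/-- A Schwinger parameter as a smooth function. -/
noncomputable def coord (a : Fin p) : smoothAlgebra p :=
  ⟨fun s => (s.1 a : ℂ), contDiffOn_extendZero _ (fun s => (s a : ℂ)) (fun _ => rfl)
    (Complex.ofRealCLM.contDiff.comp (contDiff_apply ℝ ℝ a)).contDiffOn⟩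

theorem eval_coord (a : Fin p) (s : orthant p) : eval s (coord a) = s.1 a := rfl

theorem pd_coord (a b : Fin p) : pd a (coord b) = if a = b then 1 else 0 := by
  refine eval_ext fun s => ?_
  rw [pd_apply_eq a _ (fun s => (s b : ℂ)) (fun _ => rfl)]
  have h : HasFDerivAt (fun s : Fin p → ℝ => (s b : ℂ))
      (Complex.ofRealCLM.comp (ContinuousLinearMap.proj b)) s.1 :=
    (Complex.ofRealCLM.comp (ContinuousLinearMap.proj (R := ℝ) (φ := fun _ : Fin p => ℝ) b)).hasFDerivAt
  rw [h.fderiv]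
  by_cases hab : a = b
  · subst hab; simp
  · simp [hab, Ne.symm hab]

/-- The exponential of a smooth function. -/
noncomputable def exp (f : smoothAlgebra p) : smoothAlgebra p :=
  ⟨fun s => Complex.exp (f.1 s), contDiffOn_extendZero _ (fun s => Complex.exp (extendZero f.1 s))
    (fun s => by simp [extendZero_coe]) (ContDiffOn.cexp f.2)⟩

theorem eval_exp (f : smoothAlgebra p) (s : orthant p) :
    eval s (exp f) = Complex.exp (eval s f) := rfl

theorem pd_exp (a : Fin p) (f : smoothAlgebra p) : pd a (exp f) = exp f * pd a f := by
  refine eval_ext fun s => ?_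
  rw [pd_apply_eq a _ (fun s => Complex.exp (extendZero f.1 s))
    (fun s => by simp [extendZero_coe, exp]), (smoothAlgebra.differentiableAt f s).hasFDerivAt.cexp.fderiv,
    extendZero_coe, map_mul, pd_apply]
  rfl

/-- The logarithm of a smooth function with values in the slit plane. -/
noncomputable def log (f : smoothAlgebra p) (hf : ∀ s, eval s f ∈ Complex.slitPlane) :
    smoothAlgebra p :=
  ⟨fun s => Complex.log (f.1 s), contDiffOn_extendZero _ (fun s => Complex.log (extendZero f.1 s))
    (fun s => by simp [extendZero_coe]) fun s hs =>
      (((Complex.contDiffAt_log (n := ∞) (by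
        rw [extendZero_coe f.1 ⟨s, hs⟩]; exact hf ⟨s, hs⟩)).restrict_scalars ℝ).comp_contDiffWithinAt
          s (f.2 s hs))⟩

theorem eval_log (f : smoothAlgebra p) (hf : ∀ s, eval s f ∈ Complex.slitPlane) (s : orthant p) :
    eval s (log f hf) = Complex.log (eval s f) := rfl

theorem mul_pd_log (a : Fin p) (f : smoothAlgebra p) (hf : ∀ s, eval s f ∈ Complex.slitPlane) :
    f * pd a (log f hf) = pd a f := by
  have h : exp (log f hf) = f := eval_ext fun s => by
    rw [eval_exp, eval_log, Complex.exp_log (Complex.slitPlane_ne_zero (hf s))]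
  conv_rhs => rw [← h, pd_exp, h]

/-- The inverse of a smooth function without zeros. -/
noncomputable def inv (f : smoothAlgebra p) (hf : ∀ s, eval s f ≠ 0) : smoothAlgebra p :=
  ⟨fun s => (f.1 s)⁻¹, contDiffOn_extendZero _ (fun s => (extendZero f.1 s)⁻¹)
    (fun s => by simp [extendZero_coe]) (ContDiffOn.inv f.2 fun s hs => by
      rw [extendZero_coe f.1 ⟨s, hs⟩]; exact hf ⟨s, hs⟩)⟩

theorem mul_inv (f : smoothAlgebra p) (hf : ∀ s, eval s f ≠ 0) : f * inv f hf = 1 := by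
  refine eval_ext fun s => ?_
  rw [map_mul, map_one]
  exact mul_inv_cancel₀ (hf s)

end smoothAlgebra

namespace CompleteFamily

variable {L n p : ℕ} (F : CompleteFamily L n p)

open smoothAlgebra

/-- The quadratic form at `v` is `∑ a, s_a * (∑ i, α a i * v i) ^ 2`. If it vanishes, `dotMap` kills
the vector of products `v i * v j`, so completeness forces every `v i ^ 2` to be zero. -/
theorem posDef_quadMatrix {s : Fin p → ℝ} (hs : s ∈ orthant p) : (F.quadMatrix s).PosDef := by
  have hq : ∀ v : Fin L → ℝ, v ⬝ᵥ (F.quadMatrix s).mulVec v =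
      ∑ a, s a * (∑ i, F.α a i * v i) ^ 2 := by
    intro v
    simp only [dotProduct, Matrix.mulVec, quadMatrix, Matrix.of_apply, sq, Finset.sum_mul,
      Finset.mul_sum]
    rw [Finset.sum_comm]
    conv_lhs => enter [2, j]; rw [Finset.sum_comm]
    rw [Finset.sum_comm]
    refine Finset.sum_congr rfl fun a _ => Finset.sum_congr rfl fun i _ =>
      Finset.sum_congr rfl fun j _ => ?_
    ring
  refine Matrix.PosDef.of_dotProduct_mulVec_pos ?_ fun v hv => ?_
  · ext i j
    simp [quadMatrix, mul_assoc, mul_comm (F.α _ i : ℝ)]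
  · rw [star_trivial, hq]
    refine lt_of_le_of_ne (Finset.sum_nonneg fun a _ => mul_nonneg (hs a).le (sq_nonneg _)) ?_
    intro h0
    have h1 : ∀ a, ∑ i, F.α a i * v i = 0 := by
      intro a
      have := (Finset.sum_eq_zero_iff_of_nonneg
        fun a _ => mul_nonneg (hs a).le (sq_nonneg _)).mp h0.symm a (Finset.mem_univ a)
      simpa [(hs a).ne'] using this
    let y : DotIdx L n → ℝ :=
      Sum.elim (Sym2.lift ⟨fun i j => v i * v j, fun i j => mul_comm _ _⟩) 0
    have h2 : dotMap F.α F.β y = 0 := by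
      ext a
      have h3 : dotMap F.α F.β y a = (∑ i, F.α a i * v i) * ∑ j, F.α a j * v j := by
        simp only [Finset.sum_mul_sum]
        simp [dotMap, y, mul_mul_mul_comm]
      rw [h3, h1, zero_mul, Pi.zero_apply]
    have h3 : y = 0 := F.complete.1 (by rw [h2, map_zero])
    refine hv (funext fun i => ?_)
    have := congrFun h3 (Sum.inl s(i, i))
    simpa [y] using this

theorem symanzikU_pos {s : Fin p → ℝ} (hs : s ∈ orthant p) : 0 < F.symanzikU s :=
  (F.posDef_quadMatrix hs).det_pos

/-- The matrix of the quadratic form, with smooth functions as entries. -/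
noncomputable def smoothA : Matrix (Fin L) (Fin L) (smoothAlgebra p) :=
  Matrix.of fun i j => ∑ a, (F.α a i * F.α a j : ℂ) • coord a

/-- The matrix of linear coefficients, with smooth functions as entries. -/
noncomputable def smoothB : Matrix (Fin L) (Fin n) (smoothAlgebra p) :=
  Matrix.of fun i r => ∑ a, (F.α a i * F.β a r : ℂ) • coord a

theorem map_smoothA (s : orthant p) :
    F.smoothA.map (eval s) = (F.quadMatrix s.1).map (algebraMap ℝ ℂ) := by
  ext i j
  simp only [smoothA, quadMatrix, Matrix.map_apply, Matrix.of_apply, map_sum, map_smul, eval_coord,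
    smul_eq_mul, Complex.coe_algebraMap]
  push_cast
  exact Finset.sum_congr rfl fun a _ => by ring

theorem map_smoothB (s : orthant p) :
    F.smoothB.map (eval s) = (F.linMatrix s.1).map (algebraMap ℝ ℂ) := by
  ext i j
  simp only [smoothB, linMatrix, Matrix.map_apply, Matrix.of_apply, map_sum, map_smul, eval_coord,
    smul_eq_mul, Complex.coe_algebraMap]
  push_cast
  exact Finset.sum_congr rfl fun a _ => by ring

theorem eval_det_smoothA (s : orthant p) : eval s F.smoothA.det = F.symanzikU s.1 := by
  rw [AlgHom.map_det, AlgHom.mapMatrix_apply, map_smoothA]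
  exact ((algebraMap ℝ ℂ).map_det _).symm

theorem eval_det_smoothA_mem (s : orthant p) : eval s F.smoothA.det ∈ Complex.slitPlane := by
  rw [eval_det_smoothA]
  exact Complex.ofReal_mem_slitPlane.mpr (F.symanzikU_pos s.2)

/-- The inverse of `𝒰`. -/
noncomputable def smoothUinv : smoothAlgebra p :=
  inv F.smoothA.det fun s => Complex.slitPlane_ne_zero (F.eval_det_smoothA_mem s)

/-- The exponent `ℱ / 𝒰` of the kernel. -/
noncomputable def smoothExponent (S : Matrix (Fin n) (Fin n) ℝ) (M : Fin p → ℂ) :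
    smoothAlgebra p :=
  (∑ b, (M b - F.extSq S b) • coord b) + ((F.smoothUinv • F.smoothA.adjugate) *
    (F.smoothB * S.map (fun r => algebraMap ℂ (smoothAlgebra p) r) * F.smoothB.transpose)).trace

/-- The differential algebra of smooth functions with the kernel of the Schwinger representation. -/
noncomputable def model (S : Matrix (Fin n) (Fin n) ℝ) (M : Fin p → ℂ) (w : ℂ) :
    KernelModel F S M w (smoothAlgebra p) where
  d := pd
  d_comm := pd_comm
  x := coord
  d_x := pd_coord
  A := F.smoothA
  A_apply _ _ := rfl
  B := F.smoothB
  B_apply _ _ := rfl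
  G := F.smoothUinv • F.smoothA.adjugate
  A_mul_G := by
    rw [mul_smul_comm, Matrix.mul_adjugate, smul_smul, mul_comm, smoothUinv, smoothAlgebra.mul_inv,
      one_smul]
  E := exp (w • log F.smoothA.det F.eval_det_smoothA_mem - Complex.I • F.smoothExponent S M)
  d_E a := by
    have h : (F.smoothUinv • F.smoothA.adjugate).det * F.smoothA.det = 1 := by
      rw [← Matrix.det_mul, smul_mul_assoc, Matrix.adjugate_mul, smul_smul, mul_comm, smoothUinv,
        smoothAlgebra.mul_inv, one_smul, Matrix.det_one]
    rw [pd_exp, map_sub, Derivation.map_smul, Derivation.map_smul, smoothExponent]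
    congr 4
    rw [← mul_pd_log a F.smoothA.det F.eval_det_smoothA_mem, ← mul_assoc, h, one_mul]

theorem eval_smoothExponent (S : Matrix (Fin n) (Fin n) ℝ) (M : Fin p → ℂ) (s : orthant p) :
    eval s (F.smoothExponent S M) = F.symanzikF S M s.1 / F.symanzikU s.1 := by
  have hU : (F.symanzikU s.1 : ℂ) ≠ 0 := by exact_mod_cast (F.symanzikU_pos s.2).ne'
  have h1 : eval s F.smoothUinv = (F.symanzikU s.1 : ℂ)⁻¹ := by
    rw [← eval_det_smoothA]; rfl
  have h2 : eval s (F.smoothA.adjugate * (F.smoothB *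
      S.map (fun r => algebraMap ℂ (smoothAlgebra p) r) * F.smoothB.transpose)).trace =
      (((F.quadMatrix s.1).adjugate *
        (F.linMatrix s.1 * S * (F.linMatrix s.1).transpose)).trace : ℂ) := by
    have h3 : (S.map (fun r => algebraMap ℂ (smoothAlgebra p) r)).map (eval s) =
        S.map (algebraMap ℝ ℂ) := by
      ext i j; simp
    have h4 : ∀ X : Matrix (Fin L) (Fin L) (smoothAlgebra p),
        eval s X.trace = (X.map (eval s)).trace := fun X => by simp [Matrix.trace]
    have h5 : ∀ X : Matrix (Fin L) (Fin L) ℝ,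
        ((X.trace : ℝ) : ℂ) = (X.map (algebraMap ℝ ℂ)).trace := fun X => by simp [Matrix.trace]
    have h6 : F.smoothA.adjugate.map (eval s) =
        ((F.quadMatrix s.1).map (algebraMap ℝ ℂ)).adjugate := by
      rw [← map_smoothA]; exact AlgHom.map_adjugate (eval s) F.smoothA
    have h7 : (F.quadMatrix s.1).adjugate.map (algebraMap ℝ ℂ) =
        ((F.quadMatrix s.1).map (algebraMap ℝ ℂ)).adjugate :=
      RingHom.map_adjugate (algebraMap ℝ ℂ) _
    rw [h4, h5]
    simp only [Matrix.map_mul, Matrix.transpose_map, h6, h7, h3, map_smoothB]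
  rw [smoothExponent, smul_mul_assoc, Matrix.trace_smul, map_add, smul_eq_mul, map_mul, h1, h2,
    symanzikF, symanzikFtilde]
  simp only [map_sum, map_smul, eval_coord, smul_eq_mul, sub_mul, Finset.sum_sub_distrib]
  push_cast
  field_simp
  simp only [mul_comm]
  ring

theorem eval_model_E (S : Matrix (Fin n) (Fin n) ℝ) (M : Fin p → ℂ) (D : ℂ) (s : orthant p) :
    eval s (F.model S M (-D / 2)).E = F.schwingerKernel S M D s.1 := by
  have hU : (F.symanzikU s.1 : ℂ) ≠ 0 := by exact_mod_cast (F.symanzikU_pos s.2).ne'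
  rw [schwingerKernel, Complex.cpow_def_of_ne_zero hU, ← Complex.exp_add]
  simp only [model]
  rw [eval_exp, map_sub, map_smul, map_smul, eval_log, eval_smoothExponent, eval_det_smoothA]
  congr 1
  simp only [smul_eq_mul]
  ring

theorem eval_model_det_G (S : Matrix (Fin n) (Fin n) ℝ) (M : Fin p → ℂ) (w : ℂ) (s : orthant p) :
    eval s (F.model S M w).G.det = (F.symanzikU s.1 : ℂ)⁻¹ := by
  have h := congrArg (eval s) (F.model S M w).det_A_mul_det_G
  have h2 : eval s (F.model S M w).A.det = F.symanzikU s.1 := F.eval_det_smoothA s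
  rw [map_mul, map_one, h2] at h
  exact eq_inv_of_mul_eq_one_right h

/-- The dimension enters the kernel only through the power of `𝒰`, so one extra factor `1/𝒰` raises
it by two. -/
theorem eval_model_E_mul_det_G (S : Matrix (Fin n) (Fin n) ℝ) (M : Fin p → ℂ) (D : ℂ)
    (s : orthant p) :
    eval s ((F.model S M (-D / 2)).E * (F.model S M (-D / 2)).G.det) =
      F.schwingerKernel S M (D + 2) s.1 := by
  have hU : (F.symanzikU s.1 : ℂ) ≠ 0 := by exact_mod_cast (F.symanzikU_pos s.2).ne'
  rw [map_mul, eval_model_E, eval_model_det_G, schwingerKernel, schwingerKernel, mul_right_comm,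
    ← Complex.cpow_neg_one, ← Complex.cpow_add _ _ hU]
  congr 3
  ring

end CompleteFamily

end FeynmanIntegral

/-! ### Bounds for derivatives of the kernel, and integrals of total derivatives -/

namespace FeynmanIntegral

namespace KernelModel

variable {L n p : ℕ} {F : CompleteFamily L n p} {S : Matrix (Fin n) (Fin n) ℝ}
  {M : Fin p → ℂ} {w : ℂ} {R : Type*} [CommRing R] [Algebra ℂ R] (K : KernelModel F S M w R)

/-- The polynomials in the Schwinger parameters. -/
def polys : Subalgebra ℂ R := Algebra.adjoin ℂ (Set.range K.x)

theorem x_mem_polys (a : Fin p) : K.x a ∈ K.polys := Algebra.subset_adjoin ⟨a, rfl⟩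

theorem d_mem_polys (a : Fin p) {P : R} (hP : P ∈ K.polys) : K.d a P ∈ K.polys := by
  induction hP using Algebra.adjoin_induction with
  | mem x hx =>
    obtain ⟨b, rfl⟩ := hx
    rw [K.d_x]
    split_ifs
    exacts [one_mem _, zero_mem _]
  | algebraMap r => simp
  | add x y hx hy hx' hy' => rw [map_add]; exact add_mem hx' hy'
  | mul x y hx hy hx' hy' =>
    rw [Derivation.leibniz]
    exact add_mem (mul_mem hx hy') (mul_mem hy hx')

theorem A_mem_polys (i j : Fin L) : K.A i j ∈ K.polys := by
  rw [K.A_apply]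
  exact sum_mem fun a _ => Subalgebra.smul_mem _ (K.x_mem_polys a) _

theorem B_mem_polys (i : Fin L) (r : Fin n) : K.B i r ∈ K.polys := by
  rw [K.B_apply]
  exact sum_mem fun a _ => Subalgebra.smul_mem _ (K.x_mem_polys a) _

theorem det_mem_polys (X : Matrix (Fin L) (Fin L) R) (hX : ∀ i j, X i j ∈ K.polys) :
    X.det ∈ K.polys := by
  rw [Matrix.det_apply']
  exact sum_mem fun σ _ => mul_mem (intCast_mem _ _) (prod_mem fun i _ => hX _ _)

theorem adjugate_mem_polys (i j : Fin L) : K.A.adjugate i j ∈ K.polys := by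
  rw [Matrix.adjugate_apply]
  refine K.det_mem_polys _ fun k l => ?_
  by_cases hk : k = j
  · subst hk
    rw [Matrix.updateRow_self, Pi.single_apply]
    split_ifs
    exacts [one_mem _, zero_mem _]
  · rw [Matrix.updateRow_ne hk]
    exact K.A_mem_polys k l

/-- The numerator of the trace part of the exponent. -/
def tauNum : R := (K.A.adjugate * (K.B * K.ext * K.B.transpose)).trace

theorem tauNum_mem_polys : K.tauNum ∈ K.polys := by
  simp only [tauNum, Matrix.trace, Matrix.diag_apply, Matrix.mul_apply]
  refine sum_mem fun i _ => sum_mem fun j _ => mul_mem (K.adjugate_mem_polys _ _)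
    (sum_mem fun r _ => mul_mem (sum_mem fun s _ => mul_mem (K.B_mem_polys _ _) ?_)
      (K.B_mem_polys _ _))
  exact Subalgebra.algebraMap_mem _ _

theorem tau_eq : K.tau = K.G.det * K.tauNum := by
  have h : K.G = K.G.det • K.A.adjugate := by
    calc K.G = K.G.det • ((K.A.adjugate * K.A) * K.G) := by
          rw [Matrix.adjugate_mul, smul_mul_assoc, one_mul, smul_smul, mul_comm,
            K.det_A_mul_det_G, one_smul]
      _ = _ := by rw [mul_assoc, K.A_mul_G, mul_one]
  rw [tau, tauNum]
  nth_rewrite 1 [h]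
  rw [smul_mul_assoc, Matrix.trace_smul, smul_eq_mul]

/-- The multiples of the kernel by a polynomial divided by the `k`-th power of `𝒰`. -/
def IsRegular (k : ℕ) (f : R) : Prop := ∃ P ∈ K.polys, f = K.E * K.G.det ^ k * P

theorem isRegular_E : K.IsRegular 0 K.E := ⟨1, one_mem _, by simp⟩

variable {K}

theorem IsRegular.mul_poly {k : ℕ} {f P : R} (hf : K.IsRegular k f) (hP : P ∈ K.polys) :
    K.IsRegular k (P * f) := by
  obtain ⟨Q, hQ, rfl⟩ := hf
  exact ⟨P * Q, mul_mem hP hQ, by ring⟩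

theorem IsRegular.smul {k : ℕ} {f : R} (hf : K.IsRegular k f) (c : ℂ) : K.IsRegular k (c • f) := by
  rw [Algebra.smul_def]
  exact hf.mul_poly (Subalgebra.algebraMap_mem _ _)

/-- The worst denominator comes from the exponent `tauNum / 𝒰`, whose derivative has denominator
`𝒰²`. Hence two powers of `𝒰` per derivative suffice. -/
theorem IsRegular.d {k : ℕ} {f : R} (hf : K.IsRegular k f) (a : Fin p) :
    K.IsRegular (k + 2) (K.d a f) := by
  obtain ⟨P, hP, rfl⟩ := hf
  set lin : R := ∑ b, (M b - F.extSq S b) • K.x b with hlin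
  have hlin_mem : lin ∈ K.polys :=
    sum_mem fun b _ => Subalgebra.smul_mem _ (K.x_mem_polys b) _
  have hU : K.A.det ∈ K.polys := K.det_mem_polys _ K.A_mem_polys
  have hdU := K.d_mem_polys a hU
  have h1 : K.G.det * K.A.det = 1 := by rw [mul_comm]; exact K.det_A_mul_det_G
  have h2 : K.G.det ^ 2 * K.A.det ^ 2 = 1 := by rw [← mul_pow, h1, one_pow]
  have hg : K.d a K.G.det = -K.G.det ^ 2 * K.d a K.A.det := (K.d a).leibniz_of_mul_eq_one h1
  have hgk : K.d a (K.G.det ^ k) = -(k : R) * K.G.det ^ (k + 1) * K.d a K.A.det := by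
    rw [Derivation.leibniz_pow, hg]
    cases k with
    | zero => simp
    | succ m => simp only [Nat.add_sub_cancel, nsmul_eq_mul, smul_eq_mul]; ring
  have hE : K.d a K.E = K.E * (w • (K.G.det * K.d a K.A.det) -
      Complex.I • (K.d a lin + K.d a (K.G.det * K.tauNum))) := by
    rw [← tau_eq, ← map_add]
    exact K.d_E a
  -- The numerator of the derivative over the common denominator `𝒰 ^ (k + 2)`.
  refine ⟨w • (K.A.det * K.d a K.A.det * P) - Complex.I • ((K.A.det ^ 2 * K.d a lin +
    K.A.det * K.d a K.tauNum - K.d a K.A.det * K.tauNum) * P) -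
    (k : R) * (K.A.det * K.d a K.A.det * P) + K.A.det ^ 2 * K.d a P, ?_, ?_⟩
  · have ht := K.tauNum_mem_polys
    refine add_mem (sub_mem (sub_mem (Subalgebra.smul_mem _ (mul_mem (mul_mem hU hdU) hP) _)
      (Subalgebra.smul_mem _ (mul_mem (sub_mem (add_mem (mul_mem (pow_mem hU 2)
        (K.d_mem_polys a hlin_mem)) (mul_mem hU (K.d_mem_polys a ht))) (mul_mem hdU ht)) hP) _))
      (mul_mem (natCast_mem _ _) (mul_mem (mul_mem hU hdU) hP)))
      (mul_mem (pow_mem hU 2) (K.d_mem_polys a hP))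
  · rw [Derivation.leibniz, Derivation.leibniz, hgk, hE, Derivation.leibniz, hg]
    simp only [smul_eq_mul]
    simp only [Algebra.smul_def]
    linear_combination
      (-(K.E * K.G.det ^ k * K.d a P) + algebraMap ℂ R Complex.I * P * K.E * K.G.det ^ k *
        K.d a lin) * h2 +
      (-(algebraMap ℂ R w * P * K.E * K.G.det ^ (k + 1) * K.d a K.A.det) +
        algebraMap ℂ R Complex.I * P * K.E * K.G.det ^ (k + 1) * K.d a K.tauNum +
        k * K.E * P * K.G.det ^ (k + 1) * K.d a K.A.det) * h1

theorem IsRegular.op_monomial {k : ℕ} {f : R} (hf : K.IsRegular k f) (m : Fin p →₀ ℕ) :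
    K.IsRegular (k + 2 * m.degree) (K.op (MvPolynomial.monomial m 1) f) := by
  induction hN : m.degree generalizing m with
  | zero =>
    have : m = 0 := (Finsupp.degree_eq_zero_iff m).mp hN
    subst this
    simpa using hf
  | succ N ih =>
    obtain ⟨a, ha⟩ : ∃ a, m a ≠ 0 := by
      by_contra! h
      have : m = 0 := Finsupp.ext h
      subst this
      simp at hN
    have hm : Finsupp.single a 1 + (m - Finsupp.single a 1) = m :=
      add_tsub_cancel_of_le (by simpa [Nat.one_le_iff_ne_zero] using ha)
    have hdeg : (m - Finsupp.single a 1).degree = N := by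
      have := congrArg Finsupp.degree hm
      rw [map_add, hN, Finsupp.degree_single] at this
      omega
    have h := ((ih _ hdeg).d a).smul Complex.I
    rw [← op_X, ← Module.End.mul_apply, ← map_mul, MvPolynomial.X, MvPolynomial.monomial_mul, hm,
      one_mul] at h
    exact h

end KernelModel

theorem pow_le_const_mul_exp (N : ℕ) {c : ℝ} (hc : 0 < c) :
    ∃ C, 0 ≤ C ∧ ∀ x : ℝ, 0 ≤ x → (1 + x) ^ N ≤ C * Real.exp (c * x) := by
  refine ⟨N.factorial * (c⁻¹) ^ N * Real.exp c, by positivity, fun x hx => ?_⟩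
  have h := Real.pow_div_factorial_le_exp (c * (1 + x)) (by positivity) N
  rw [div_le_iff₀ (by positivity), mul_pow] at h
  have h2 : (1 + x) ^ N = (c⁻¹) ^ N * (c ^ N * (1 + x) ^ N) := by
    rw [← mul_assoc, ← mul_pow, inv_mul_cancel₀ hc.ne', one_pow, one_mul]
  rw [h2]
  calc (c⁻¹) ^ N * (c ^ N * (1 + x) ^ N)
      ≤ (c⁻¹) ^ N * (Real.exp (c * (1 + x)) * N.factorial) := by gcongr
    _ = _ := by rw [mul_add, mul_one, Real.exp_add]; ring

open smoothAlgebra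

theorem eval_eq_extendZero {p : ℕ} (f : smoothAlgebra p) (s : orthant p) :
    eval s f = extendZero f.1 s.1 :=
  (extendZero_coe f.1 s).symm

namespace CompleteFamily

variable {L n p : ℕ} {F : CompleteFamily L n p} {S : Matrix (Fin n) (Fin n) ℝ} {M : Fin p → ℂ}

theorem norm_poly_le {w : ℂ} {P : smoothAlgebra p} (hP : P ∈ (F.model S M w).polys) :
    ∃ (C : ℝ) (N : ℕ), 0 ≤ C ∧ ∀ s : orthant p, ‖eval s P‖ ≤ C * (1 + ∑ a, s.1 a) ^ N := by
  have hs : ∀ s : orthant p, 1 ≤ 1 + ∑ a, s.1 a := fun s => by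
    linarith [Finset.sum_nonneg fun a (_ : a ∈ Finset.univ) => (s.2 a).le]
  induction hP using Algebra.adjoin_induction with
  | mem x hx =>
    obtain ⟨a, rfl⟩ := hx
    refine ⟨1, 1, zero_le_one, fun s => ?_⟩
    change ‖(s.1 a : ℂ)‖ ≤ _
    rw [Complex.norm_real, Real.norm_of_nonneg (s.2 a).le, one_mul, pow_one]
    linarith [Finset.single_le_sum (f := s.1) (fun a _ => (s.2 a).le) (Finset.mem_univ a)]
  | algebraMap r => exact ⟨‖r‖, 0, norm_nonneg _, fun s => by simp⟩
  | add x y hx hy hx' hy' =>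
    obtain ⟨C₁, N₁, h₁, h₁'⟩ := hx'
    obtain ⟨C₂, N₂, h₂, h₂'⟩ := hy'
    refine ⟨C₁ + C₂, max N₁ N₂, add_nonneg h₁ h₂, fun s => ?_⟩
    rw [map_add, add_mul]
    refine (norm_add_le _ _).trans (add_le_add ((h₁' s).trans ?_) ((h₂' s).trans ?_))
    · exact mul_le_mul_of_nonneg_left (pow_le_pow_right₀ (hs s) (le_max_left _ _)) h₁
    · exact mul_le_mul_of_nonneg_left (pow_le_pow_right₀ (hs s) (le_max_right _ _)) h₂
  | mul x y hx hy hx' hy' =>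
    obtain ⟨C₁, N₁, h₁, h₁'⟩ := hx'
    obtain ⟨C₂, N₂, h₂, h₂'⟩ := hy'
    refine ⟨C₁ * C₂, N₁ + N₂, mul_nonneg h₁ h₂, fun s => ?_⟩
    rw [map_mul, norm_mul, pow_add, mul_mul_mul_comm]
    exact mul_le_mul (h₁' s) (h₂' s) (norm_nonneg _) ((norm_nonneg _).trans (h₁' s))

/-- `𝒰` and `ℱ̃` are real, so they and the real parts of the masses contribute only a phase to the
exponential; the damping comes from `Im M_a = -η` alone. -/
theorem norm_schwingerKernel {η : ℝ} (hM : ∀ a, (M a).im = -η) (D : ℂ) {s : Fin p → ℝ}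
    (hs : s ∈ orthant p) :
    ‖F.schwingerKernel S M D s‖ = F.symanzikU s ^ (-D / 2).re * Real.exp (-η * ∑ a, s a) := by
  have hU : (F.symanzikU s : ℂ) ≠ 0 := by exact_mod_cast (F.symanzikU_pos hs).ne'
  rw [schwingerKernel, norm_mul, Complex.norm_cpow_eq_rpow_re_of_pos (F.symanzikU_pos hs),
    Complex.norm_exp]
  congr 2
  have h : F.symanzikF S M s / F.symanzikU s =
      (∑ a, M a * s a) + ((F.symanzikFtilde S s / F.symanzikU s : ℝ) : ℂ) := by
    rw [symanzikF]
    push_cast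
    field_simp
  rw [h]
  simp [Complex.mul_im, hM, Finset.mul_sum]

/-- The condition on `k` keeps the net exponent of `𝒰` nonnegative, so there is no singularity where
`𝒰` tends to zero at the boundary. What is left grows polynomially and is absorbed by half of the
damping. -/
theorem IsRegular_norm_le {η : ℝ} (hη : 0 < η) (hM : ∀ a, (M a).im = -η) {D : ℂ} {k : ℕ}
    (hk : (k : ℝ) ≤ (-D / 2).re) {f : smoothAlgebra p}
    (hf : (F.model S M (-D / 2)).IsRegular k f) :
    ∃ C, 0 ≤ C ∧ ∀ s : orthant p, ‖eval s f‖ ≤ C * Real.exp (-(η / 2) * ∑ a, s.1 a) := by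
  obtain ⟨P, hP, rfl⟩ := hf
  set K := F.model S M (-D / 2) with hK
  set m := ⌈(-D / 2).re - k⌉₊ with hm
  have hU : K.A.det ∈ K.polys := K.det_mem_polys _ K.A_mem_polys
  obtain ⟨C₁, N, hC₁, h₁⟩ := norm_poly_le (mul_mem (pow_mem (add_mem (one_mem _) hU) m) hP)
  obtain ⟨C₂, hC₂, h₂⟩ := pow_le_const_mul_exp N (half_pos hη)
  refine ⟨C₁ * C₂, mul_nonneg hC₁ hC₂, fun s => ?_⟩
  have hpos := F.symanzikU_pos s.2
  have hsum : 0 ≤ ∑ a, s.1 a := Finset.sum_nonneg fun a _ => (s.2 a).le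
  have hUs : eval s K.A.det = F.symanzikU s.1 := F.eval_det_smoothA s
  have h₃ : ‖eval s ((1 + K.A.det) ^ m * P)‖ = (1 + F.symanzikU s.1) ^ m * ‖eval s P‖ := by
    rw [map_mul, map_pow, map_add, map_one, hUs, norm_mul, norm_pow]
    congr 2
    rw [← Complex.ofReal_one, ← Complex.ofReal_add, Complex.norm_real,
      Real.norm_of_nonneg (by positivity)]
  have h₄ : F.symanzikU s.1 ^ (-D / 2).re * (F.symanzikU s.1)⁻¹ ^ k ≤ (1 + F.symanzikU s.1) ^ m := by
    rw [inv_pow, ← Real.rpow_natCast (F.symanzikU s.1) k, ← Real.rpow_neg hpos.le,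
      ← Real.rpow_add hpos, ← Real.rpow_natCast _ m]
    calc F.symanzikU s.1 ^ ((-D / 2).re + -(k : ℝ))
        ≤ (1 + F.symanzikU s.1) ^ ((-D / 2).re + -(k : ℝ)) :=
          Real.rpow_le_rpow hpos.le (by linarith) (by linarith)
      _ ≤ _ := Real.rpow_le_rpow_of_exponent_le (by linarith)
          (by rw [← sub_eq_add_neg]; exact Nat.le_ceil _)
  rw [map_mul, map_mul, map_pow, norm_mul, norm_mul, norm_pow, hK, eval_model_E,
    eval_model_det_G, norm_schwingerKernel hM D s.2, norm_inv, Complex.norm_real,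
    Real.norm_of_nonneg hpos.le]
  calc F.symanzikU s.1 ^ (-D / 2).re * Real.exp (-η * ∑ a, s.1 a) * (F.symanzikU s.1)⁻¹ ^ k *
        ‖eval s P‖
      = (F.symanzikU s.1 ^ (-D / 2).re * (F.symanzikU s.1)⁻¹ ^ k) * ‖eval s P‖ *
        Real.exp (-η * ∑ a, s.1 a) := by ring
    _ ≤ (1 + F.symanzikU s.1) ^ m * ‖eval s P‖ * Real.exp (-η * ∑ a, s.1 a) := by gcongr
    _ ≤ (C₁ * (C₂ * Real.exp (η / 2 * ∑ a, s.1 a))) * Real.exp (-η * ∑ a, s.1 a) := by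
        rw [← h₃]
        gcongr
        exact (h₁ s).trans (mul_le_mul_of_nonneg_left (h₂ _ hsum) hC₁)
    _ = C₁ * C₂ * Real.exp (-(η / 2) * ∑ a, s.1 a) := by
        rw [mul_assoc, mul_assoc, ← Real.exp_add, mul_assoc]
        congr 3
        ring

end CompleteFamily

theorem measurableSet_orthant (p : ℕ) : MeasurableSet (orthant p) :=
  (isOpen_orthant p).measurableSet

theorem integrableOn_exp_orthant (p : ℕ) {c : ℝ} (hc : 0 < c) :
    IntegrableOn (fun s : Fin p → ℝ => Real.exp (-c * ∑ a, s a)) (orthant p) := by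
  have h : orthant p = Set.univ.pi fun _ => Set.Ioi 0 := by
    ext s; simp [orthant]
  have h2 : (fun s : Fin p → ℝ => Real.exp (-c * ∑ a, s a)) = fun s => ∏ a, Real.exp (-c * s a) := by
    ext s
    rw [Finset.mul_sum, Real.exp_sum]
  rw [IntegrableOn, h, h2, volume_pi, Measure.restrict_pi_pi]
  exact Integrable.fintype_prod fun _ => integrableOn_exp_mul_Ioi (neg_lt_zero.mpr hc) 0

theorem smoothAlgebra.integrableOn {p : ℕ} (f : smoothAlgebra p) {C c : ℝ} (hc : 0 < c)
    (hf : ∀ s : orthant p, ‖eval s f‖ ≤ C * Real.exp (-c * ∑ a, s.1 a)) :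
    IntegrableOn (extendZero f.1) (orthant p) := by
  refine Integrable.mono' ((integrableOn_exp_orthant p hc).const_mul C)
    (f.2.continuousOn.aestronglyMeasurable (measurableSet_orthant p)) ?_
  filter_upwards [ae_restrict_mem (measurableSet_orthant p)] with s hs
  have := hf ⟨s, hs⟩
  rwa [eval_eq_extendZero] at this

theorem extendZero_of_notMem {p : ℕ} (f : orthant p → ℂ) {s : Fin p → ℝ} (hs : s ∉ orthant p) :
    extendZero f s = 0 := by
  rw [extendZero, Function.extend_apply']
  · rfl
  · rintro ⟨t, rfl⟩
    exact hs t.2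

theorem insertNth_mem_orthant {p : ℕ} (a : Fin (p + 1)) (t : ℝ) (y : Fin p → ℝ) :
    a.insertNth t y ∈ orthant (p + 1) ↔ 0 < t ∧ y ∈ orthant p := by
  change (∀ b, 0 < (a.insertNth t y : Fin (p + 1) → ℝ) b) ↔ _
  rw [Fin.forall_iff_succAbove a]
  simp [orthant]

/-- The bound makes `h` vanish both as `s_a → 0` and as `s_a → ∞`, so the fundamental theorem of
calculus gives zero along each line. -/
theorem integral_line_pd {p : ℕ} (a : Fin (p + 1)) (h : smoothAlgebra (p + 1)) {C c : ℝ}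
    (hC : 0 ≤ C) (hc : 0 < c)
    (hb : ∀ s : orthant (p + 1), ‖eval s h‖ ≤ s.1 a * (C * Real.exp (-c * ∑ a, s.1 a)))
    (y : Fin p → ℝ) : ∫ t : ℝ, extendZero (pd a h).1 (a.insertNth t y) = 0 := by
  by_cases hy : y ∈ orthant p
  swap
  · refine integral_eq_zero_of_ae (Eventually.of_forall fun t => extendZero_of_notMem _ ?_)
    rw [insertNth_mem_orthant]
    exact fun h => hy h.2
  rw [← setIntegral_eq_integral_of_forall_compl_eq_zero (s := Set.Ioi 0) (fun t ht =>
    extendZero_of_notMem _ (by rw [insertNth_mem_orthant]; exact fun h => ht h.1))]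
  -- On a line where the derivative is not integrable the Bochner integral is zero by convention, so
  -- integrability need not be assumed.
  by_cases hint : IntegrableOn (fun t => extendZero (pd a h).1 (a.insertNth t y)) (Set.Ioi 0)
  swap
  · exact integral_undef hint
  have hbound : ∀ t, 0 ≤ t →
      ‖extendZero h.1 (a.insertNth t y)‖ ≤ t * (C * Real.exp (-c * t)) := by
    intro t ht
    rcases ht.eq_or_lt with rfl | ht
    · rw [extendZero_of_notMem _ (by rw [insertNth_mem_orthant]; simp)]
      simp
    · have hm : a.insertNth t y ∈ orthant (p + 1) := (insertNth_mem_orthant a t y).mpr ⟨ht, hy⟩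
      have h1 := hb ⟨_, hm⟩
      rw [eval_eq_extendZero] at h1
      refine h1.trans ?_
      simp only [Fin.insertNth_apply_same]
      have hsum : t ≤ ∑ b, (a.insertNth t y : Fin (p + 1) → ℝ) b := by
        rw [Fin.sum_univ_succAbove _ a]
        simp only [Fin.insertNth_apply_same, Fin.insertNth_apply_succAbove]
        linarith [Finset.sum_nonneg fun b (_ : b ∈ Finset.univ) => (hy b).le]
      exact mul_le_mul_of_nonneg_left (mul_le_mul_of_nonneg_left
        (Real.exp_le_exp.mpr (mul_le_mul_of_nonpos_left hsum (neg_nonpos.mpr hc.le))) hC) ht.le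
  have hlim : Tendsto (fun t : ℝ => t * (C * Real.exp (-c * t))) atTop (𝓝 0) := by
    have h1 := (Real.tendsto_pow_mul_exp_neg_atTop_nhds_zero 1).comp
      (tendsto_id.const_mul_atTop hc)
    have h2 := h1.const_mul (C / c)
    rw [mul_zero] at h2
    refine h2.congr fun t => ?_
    simp only [Function.comp_apply, id, pow_one, neg_mul]
    field_simp
  have h0 : extendZero h.1 (a.insertNth 0 y) = 0 :=
    extendZero_of_notMem _ (by rw [insertNth_mem_orthant]; simp)
  rw [integral_Ioi_of_hasDerivAt_of_tendsto (m := 0)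
    (f := fun t => extendZero h.1 (a.insertNth t y)) ?_ ?_ hint ?_]
  · rw [h0, sub_zero]
  · rw [ContinuousWithinAt, h0]
    refine squeeze_zero_norm' (eventually_nhdsWithin_of_forall hbound) ?_
    have h1 : Continuous fun t : ℝ => t * (C * Real.exp (-c * t)) := by fun_prop
    have h2 := (h1.tendsto 0).mono_left (nhdsWithin_le_nhds (s := Set.Ici 0))
    simpa using h2
  · intro t ht
    have hm : a.insertNth t y ∈ orthant (p + 1) := (insertNth_mem_orthant a t y).mpr ⟨ht, hy⟩
    have h1 := smoothAlgebra.hasDerivAt a h ⟨_, hm⟩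
    simp only [Fin.update_insertNth, Fin.insertNth_apply_same] at h1
    rwa [eval_eq_extendZero] at h1
  · refine squeeze_zero_norm' ?_ hlim
    filter_upwards [eventually_ge_atTop 0] with t ht using hbound t ht

theorem integral_pd_eq_zero {p : ℕ} (a : Fin p) (h : smoothAlgebra p) {C c : ℝ} (hC : 0 ≤ C)
    (hc : 0 < c)
    (hb : ∀ s : orthant p, ‖eval s h‖ ≤ s.1 a * (C * Real.exp (-c * ∑ a, s.1 a))) :
    ∫ s in orthant p, extendZero (pd a h).1 s = 0 := by
  obtain _ | p := p
  · exact a.elim0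
  rw [setIntegral_eq_integral_of_forall_compl_eq_zero (fun s hs => extendZero_of_notMem _ hs)]
  by_cases hint : Integrable (extendZero (pd a h).1)
  swap
  · exact integral_undef hint
  have hmp := (volume_preserving_piFinSuccAbove (fun _ : Fin (p + 1) => ℝ) a).symm
  rw [← hmp.integral_comp']
  have hint2 := (hmp.integrable_comp_emb (MeasurableEquiv.measurableEmbedding _)).mpr hint
  rw [Measure.volume_eq_prod] at hint2 ⊢
  -- Fubini with coordinate `a` as the inner variable.
  have h2 := integral_prod_symm _ hint2
  refine h2.trans (integral_eq_zero_of_ae (Eventually.of_forall fun y => ?_))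
  exact integral_line_pd a h hC hc hb y

end FeynmanIntegral

/-! ### Lowering operators and the recurrence in the convergent region -/

namespace FeynmanIntegral

open smoothAlgebra

/-- The representation of polynomials by differential operators on smooth functions,
`X a ↦ i * ∂ / ∂ s a`. -/
noncomputable def smoothOp (p : ℕ) : MvPolynomial (Fin p) ℂ →ₐ[ℂ] Module.End ℂ (smoothAlgebra p) :=
  evalCommuting (fun a => Complex.I • (pd a : smoothAlgebra p →ₗ[ℂ] smoothAlgebra p))
    fun a b => by
      ext1 f
      simp [pd_comm a b]

theorem smoothOp_X {p : ℕ} (a : Fin p) (f : smoothAlgebra p) :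
    smoothOp p (MvPolynomial.X a) f = Complex.I • pd a f := by
  simp [smoothOp, evalCommuting_X]

theorem CompleteFamily.model_op {L n p : ℕ} (F : CompleteFamily L n p)
    (S : Matrix (Fin n) (Fin n) ℝ) (M : Fin p → ℂ) (w : ℂ) : (F.model S M w).op = smoothOp p := rfl

/-- The density `∏ a, s_a ^ (ν_a - 1) / Γ(ν_a)`, where factors with `ν_a ≤ 0` are replaced by `1`. -/
noncomputable def density {p : ℕ} (ν : Fin p → ℤ) : smoothAlgebra p :=
  ∏ a, ((((ν a - 1).toNat.factorial : ℂ)⁻¹) • coord a ^ (ν a - 1).toNat)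

/-- The derivatives that are moved to the kernel for exponents `ν_a ≤ 0`. -/
noncomputable def symbol {p : ℕ} (ν : Fin p → ℤ) : MvPolynomial (Fin p) ℂ :=
  ∏ a, MvPolynomial.X a ^ (1 - ν a).toNat

/-- The integral of a smooth function against the Schwinger density for the exponents `ν`. -/
noncomputable def pairing {p : ℕ} (ν : Fin p → ℤ) (f : smoothAlgebra p) : ℂ :=
  (∏ a, Complex.I ^ max (ν a) 1) *
    ∫ s in orthant p, extendZero (density ν * smoothOp p (symbol ν) f).1 s

/-- The extension by zero as a linear map. -/
noncomputable def extendLinear (p : ℕ) : smoothAlgebra p →ₗ[ℂ] (Fin p → ℝ) → ℂ where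
  toFun f := extendZero f.1
  map_add' f g := by
    ext s
    by_cases hs : s ∈ orthant p
    · have h : ∀ f : orthant p → ℂ, extendZero f s = f ⟨s, hs⟩ :=
        fun f => extendZero_coe f ⟨s, hs⟩
      simp [h]
    · simp [extendZero_of_notMem _ hs]
  map_smul' c f := by
    ext s
    by_cases hs : s ∈ orthant p
    · have h : ∀ f : orthant p → ℂ, extendZero f s = f ⟨s, hs⟩ :=
        fun f => extendZero_coe f ⟨s, hs⟩
      simp [h]
    · simp [extendZero_of_notMem _ hs]

theorem extendZero_smul {p : ℕ} (c : ℂ) (f : smoothAlgebra p) (s : Fin p → ℝ) :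
    extendZero (c • f).1 s = c * extendZero f.1 s :=
  congrFun ((extendLinear p).map_smul c f) s

theorem extendZero_add {p : ℕ} (f g : smoothAlgebra p) (s : Fin p → ℝ) :
    extendZero (f + g).1 s = extendZero f.1 s + extendZero g.1 s :=
  congrFun ((extendLinear p).map_add f g) s

theorem extendZero_sum {p : ℕ} {ι : Type*} (t : Finset ι) (f : ι → smoothAlgebra p)
    (s : Fin p → ℝ) : extendZero (∑ i ∈ t, f i).1 s = ∑ i ∈ t, extendZero (f i).1 s := by
  have h := congrFun (map_sum (extendLinear p) f t) s
  rw [Finset.sum_apply] at h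
  exact h

section MixedPartial

variable {p : ℕ}

theorem partialDeriv_eq (a : Fin p) {g : (Fin p → ℝ) → ℂ} {f : smoothAlgebra p}
    (h : ∀ s : orthant p, g s = eval s f) (s : orthant p) :
    partialDeriv a g s = eval s (pd a f) := by
  rw [← (smoothAlgebra.hasDerivAt a f s).deriv, partialDeriv]
  refine Filter.EventuallyEq.deriv_eq ?_
  have hc : ContinuousAt (fun t => Function.update s.1 a t) (s.1 a) := by fun_prop
  have hm : orthant p ∈ 𝓝 (Function.update s.1 a (s.1 a)) := by
    rw [Function.update_eq_self]
    exact (isOpen_orthant p).mem_nhds s.2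
  filter_upwards [hc.preimage_mem_nhds hm] with t ht
  rw [h ⟨_, ht⟩, eval_eq_extendZero]

theorem mixedPartial_eq (m : Fin p → ℕ) {g : (Fin p → ℝ) → ℂ} {f : smoothAlgebra p}
    (h : ∀ s : orthant p, g s = eval s f) (s : orthant p) :
    Complex.I ^ (∑ a, m a) * mixedPartial m g s =
      eval s (smoothOp p (∏ a, MvPolynomial.X a ^ m a) f) := by
  have hiter : ∀ (a : Fin p) (k : ℕ) (g : (Fin p → ℝ) → ℂ) (f : smoothAlgebra p),
      (∀ s : orthant p, g s = eval s f) →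
      ∀ s : orthant p, (partialDeriv a)^[k] g s = eval s ((pd a)^[k] f) := by
    intro a k
    induction k with
    | zero => exact fun g f h => h
    | succ k ih => exact fun g f h => ih _ _ (partialDeriv_eq a h)
  have hop : ∀ (a : Fin p) (k : ℕ) (f : smoothAlgebra p),
      smoothOp p (MvPolynomial.X a ^ k) f = Complex.I ^ k • (pd a)^[k] f := by
    intro a k
    induction k with
    | zero => simp
    | succ k ih =>
      intro f
      rw [pow_succ, map_mul (smoothOp p), Module.End.mul_apply, smoothOp_X, map_smul, ih, smul_smul,
        pow_succ', Function.iterate_succ_apply]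
  have hlist : ∀ l : List (Fin p),
      (∀ s : orthant p, l.foldr (fun a g => (partialDeriv a)^[m a] g) g s =
        eval s (l.foldr (fun a f => (pd a)^[m a] f) f)) ∧
      smoothOp p (l.map fun a => MvPolynomial.X a ^ m a).prod f =
        Complex.I ^ (l.map m).sum • l.foldr (fun a f => (pd a)^[m a] f) f := by
    intro l
    induction l with
    | nil => exact ⟨h, by simp⟩
    | cons a l ih =>
      refine ⟨hiter a (m a) _ _ ih.1, ?_⟩
      rw [List.map_cons, List.prod_cons, map_mul (smoothOp p), Module.End.mul_apply, ih.2, map_smul,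
        hop, smul_smul, List.map_cons, List.sum_cons, ← pow_add, add_comm, List.foldr_cons]
  obtain ⟨h1, h2⟩ := hlist (List.finRange p)
  rw [Fin.prod_univ_def, Fin.sum_univ_def, h2, map_smul, mixedPartial, h1, smul_eq_mul]

end MixedPartial

/-- With `k = (1 - ν a).toNat`, the sign `(-1) ^ k` is split as `i ^ k * i ^ k`. One factor turns `∂
^ k` into `(i∂) ^ k`; the other turns `i ^ ν a` into `i ^ max (ν a) 1`. -/
theorem schwingerIntegral_eq_pairing {L n p : ℕ} (F : CompleteFamily L n p)
    (S : Matrix (Fin n) (Fin n) ℝ) (M : Fin p → ℂ) (ν : Fin p → ℤ) (D : ℂ) :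
    F.schwingerIntegral S M ν D = Complex.exp (-(Real.pi * Complex.I * L * D / 4)) *
      pairing ν (F.model S M (-D / 2)).E := by
  have hI : (∏ a, Complex.I ^ max (ν a) 1) =
      (∏ a, Complex.I ^ ν a) * Complex.I ^ (∑ a, (1 - ν a).toNat) := by
    rw [← Finset.prod_pow_eq_pow_sum, ← Finset.prod_mul_distrib]
    refine Finset.prod_congr rfl fun a _ => ?_
    rw [← zpow_natCast, ← zpow_add₀ Complex.I_ne_zero]
    congr 1
    omega
  rw [CompleteFamily.schwingerIntegral, pairing, hI, mul_assoc, mul_assoc (∏ a, Complex.I ^ ν a),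
    ← integral_const_mul (Complex.I ^ _)]
  congr 2
  refine setIntegral_congr_fun (measurableSet_orthant p) fun s hs => ?_
  have h := mixedPartial_eq (fun a => (1 - ν a).toNat)
    (fun s => (F.eval_model_E S M D s).symm) ⟨s, hs⟩
  change _ = _ * extendZero _ (⟨s, hs⟩ : orthant p).1
  rw [← eval_eq_extendZero, map_mul, symbol, ← h]
  have hd : eval ⟨s, hs⟩ (density ν) =
      ∏ a, ((s a : ℂ) ^ (ν a - 1).toNat / ((ν a - 1).toNat.factorial : ℂ)) := by
    simp [density, map_prod, eval_coord, div_eq_inv_mul]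
  rw [CompleteFamily.schwingerIntegrand, Finset.prod_mul_distrib, hd, Finset.prod_pow_eq_pow_sum,
    ← Complex.I_mul_I, mul_pow]
  ring

theorem prod_update_mul {p : ℕ} {A : Type*} [CommMonoid A] (φ : Fin p → ℤ → A) (ν : Fin p → ℤ)
    (a : Fin p) (x : ℤ) {y z : A} (h : y * φ a x = z * φ a (ν a)) :
    y * ∏ b, φ b (Function.update ν a x b) = z * ∏ b, φ b (ν b) := by
  rw [← Finset.mul_prod_erase Finset.univ (fun b => φ b (ν b)) (Finset.mem_univ a),
    ← Finset.mul_prod_erase Finset.univ (fun b => φ b (Function.update ν a x b))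
      (Finset.mem_univ a), Function.update_self, ← mul_assoc, h, mul_assoc]
  congr 2
  refine Finset.prod_congr rfl fun b hb => ?_
  rw [Function.update_of_ne (Finset.ne_of_mem_erase hb)]

section Lowering

variable {L n p : ℕ} {F : CompleteFamily L n p} {S : Matrix (Fin n) (Fin n) ℝ} {M : Fin p → ℂ}

theorem density_mem_polys (w : ℂ) (ν : Fin p → ℤ) : density ν ∈ (F.model S M w).polys :=
  prod_mem fun a _ => Subalgebra.smul_mem _ (pow_mem ((F.model S M w).x_mem_polys a) _) _

theorem symbol_eq_monomial (ν : Fin p → ℤ) : symbol ν =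
    MvPolynomial.monomial (Finsupp.equivFunOnFinite.symm fun a => (1 - ν a).toNat) 1 := by
  rw [MvPolynomial.monomial_eq, Finsupp.prod_fintype _ _ (by simp)]
  simp [symbol]

/-- The number of derivatives in `symbol`. -/
def symbolDegree (ν : Fin p → ℤ) : ℕ := ∑ a, (1 - ν a).toNat

theorem isRegular_symbol {D : ℂ} {k : ℕ} {f : smoothAlgebra p}
    (hf : (F.model S M (-D / 2)).IsRegular k f) (ν : Fin p → ℤ) :
    (F.model S M (-D / 2)).IsRegular (k + 2 * symbolDegree ν) (smoothOp p (symbol ν) f) := by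
  rw [symbol_eq_monomial]
  have h := hf.op_monomial (Finsupp.equivFunOnFinite.symm fun a => (1 - ν a).toNat)
  rw [Finsupp.degree_eq_sum] at h
  exact h

variable {η : ℝ} (hη : 0 < η) (hM : ∀ a, (M a).im = -η) {D : ℂ}
include hη hM

theorem integrableOn_of_isRegular {k : ℕ} (hk : (k : ℝ) ≤ (-D / 2).re) {f : smoothAlgebra p}
    (hf : (F.model S M (-D / 2)).IsRegular k f) : IntegrableOn (extendZero f.1) (orthant p) := by
  obtain ⟨C, -, hC⟩ := CompleteFamily.IsRegular_norm_le hη hM hk hf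
  exact smoothAlgebra.integrableOn f (half_pos hη) hC

/-- The derivative of `s ^ (ν - 1) / Γ(ν)` is the same density with `ν` lowered by one. For `ν a ≥
2` the density still contains a factor `s_a`, which removes the boundary term at zero. -/
theorem integral_by_parts {k : ℕ} (hk : ((k + 2 : ℕ) : ℝ) ≤ (-D / 2).re) {h : smoothAlgebra p}
    (hh : (F.model S M (-D / 2)).IsRegular k h) (ν : Fin p → ℤ) (a : Fin p) (ha : 2 ≤ ν a) :
    ∫ s in orthant p, extendZero (density (Function.update ν a (ν a - 1)) * h).1 s =
      -∫ s in orthant p, extendZero (density ν * pd a h).1 s := by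
  set K := F.model S M (-D / 2) with hK
  obtain ⟨κ, hκ⟩ : ∃ κ : ℕ, ν a = κ + 2 := ⟨(ν a - 2).toNat, by omega⟩
  have hk1 : (ν a - 1).toNat = κ + 1 := by omega
  have hk2 : (ν a - 1 - 1).toNat = κ := by omega
  have hfac : (((κ + 1).factorial : ℂ))⁻¹ * (κ + 1 : ℕ) = ((κ.factorial : ℂ))⁻¹ := by
    have h1 : ((κ + 1 : ℕ) : ℂ) ≠ 0 := by exact_mod_cast κ.succ_ne_zero
    have h2 : (κ.factorial : ℂ) ≠ 0 := by exact_mod_cast κ.factorial_ne_zero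
    rw [Nat.factorial_succ, Nat.cast_mul]
    field_simp
  let φ : Fin p → ℤ → smoothAlgebra p := fun b x =>
    (((x - 1).toNat.factorial : ℂ)⁻¹) • coord b ^ (x - 1).toNat
  have hpoly : ∀ ν : Fin p → ℤ, density ν ∈ K.polys := density_mem_polys _
  have hx : ((κ + 1 : ℕ) : smoothAlgebra p) * density ν =
      coord a * density (Function.update ν a (ν a - 1)) := by
    refine (prod_update_mul φ ν a (ν a - 1) ?_).symm
    simp only [φ, hk1, hk2, ← hfac, Algebra.smul_def, map_mul, map_natCast]
    ring
  have hder : pd a (density ν) = density (Function.update ν a (ν a - 1)) := by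
    have h1 : density ν = φ a (ν a) * ∏ b ∈ Finset.univ.erase a, φ b (ν b) :=
      (Finset.mul_prod_erase Finset.univ (fun b => φ b (ν b)) (Finset.mem_univ a)).symm
    have h2 : density (Function.update ν a (ν a - 1)) =
        φ a (ν a - 1) * ∏ b ∈ Finset.univ.erase a, φ b (ν b) := by
      refine (Finset.mul_prod_erase Finset.univ
        (fun b => φ b (Function.update ν a (ν a - 1) b)) (Finset.mem_univ a)).symm.trans ?_
      rw [Function.update_self]
      congr 1
      refine Finset.prod_congr rfl fun b hb => ?_
      rw [Function.update_of_ne (Finset.ne_of_mem_erase hb)]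
    have h3 : pd a (∏ b ∈ Finset.univ.erase a, φ b (ν b)) = 0 := by
      rw [leibniz_prod]
      refine Finset.sum_eq_zero fun b hb => Finset.prod_eq_zero hb ?_
      rw [Function.update_self, Derivation.map_smul, Derivation.leibniz_pow, pd_coord,
        if_neg (Finset.ne_of_mem_erase hb).symm]
      simp
    rw [h1, h2, Derivation.leibniz, h3, smul_zero, zero_add, smul_eq_mul, mul_comm]
    congr 1
    simp only [φ, hk1, hk2]
    rw [Derivation.map_smul, Derivation.leibniz_pow, pd_coord, if_pos rfl, ← hfac]
    simp only [Nat.add_sub_cancel, nsmul_eq_mul, smul_eq_mul, mul_one, mul_smul, Nat.cast_smul_eq_nsmul]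
  have hzero : ∫ s in orthant p, extendZero (pd a (density ν * h)).1 s = 0 := by
    have hreg := (hh.mul_poly (hpoly (Function.update ν a (ν a - 1)))).smul
      (((κ + 1 : ℕ) : ℂ)⁻¹)
    obtain ⟨C, hC, hb⟩ := CompleteFamily.IsRegular_norm_le hη hM
      (le_trans (by push_cast; linarith) hk) hreg
    refine integral_pd_eq_zero a _ hC (half_pos hη) fun s => ?_
    have h1 : density ν * h =
        coord a * ((((κ + 1 : ℕ) : ℂ)⁻¹) • (density (Function.update ν a (ν a - 1)) * h)) := by
      rw [mul_smul_comm, ← mul_assoc, ← hx, Algebra.smul_def, ← mul_assoc, ← mul_assoc,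
        ← map_natCast (algebraMap ℂ (smoothAlgebra p)), ← map_mul, inv_mul_cancel₀
        (by exact_mod_cast κ.succ_ne_zero), map_one, one_mul]
    rw [h1, map_mul, norm_mul, eval_coord, Complex.norm_real, Real.norm_of_nonneg (s.2 a).le]
    exact mul_le_mul_of_nonneg_left (hb s) (s.2 a).le
  have h1 := integrableOn_of_isRegular hη hM (le_trans (by push_cast; linarith) hk)
    (hh.mul_poly (hpoly (Function.update ν a (ν a - 1))))
  have h2 := integrableOn_of_isRegular hη hM hk ((hh.d a).mul_poly (hpoly ν))
  rw [eq_neg_iff_add_eq_zero, ← hzero]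
  refine (integral_add h1 h2).symm.trans ?_
  simp only [← extendZero_add]
  rw [Derivation.leibniz, hder, smul_eq_mul, smul_eq_mul, add_comm, mul_comm h]
  rfl

/-- For `ν a ≤ 1` lowering only adds one factor `X a` to `symbol`. For `ν a ≥ 2` it lowers the
density; the minus sign of the integration by parts is the `i²` formed by the phase lost from the
prefactor and the `i` in `i∂`. -/
theorem pairing_lower_one {k : ℕ} {f : smoothAlgebra p}
    (hf : (F.model S M (-D / 2)).IsRegular k f) (ν : Fin p → ℤ)
    (hk : ((k + 2 * symbolDegree ν + 2 : ℕ) : ℝ) ≤ (-D / 2).re) (a : Fin p) :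
    pairing (Function.update ν a (ν a - 1)) f = pairing ν (smoothOp p (MvPolynomial.X a) f) := by
  rcases le_or_gt (ν a) 1 with ha | ha
  · have h1 : symbol (Function.update ν a (ν a - 1)) = symbol ν * MvPolynomial.X a := by
      have := prod_update_mul (fun b x => (MvPolynomial.X b : MvPolynomial (Fin p) ℂ) ^ (1 - x).toNat)
        ν a (ν a - 1) (y := 1) (z := MvPolynomial.X a) (by
          rw [one_mul, ← pow_succ']; congr 1; omega)
      rw [one_mul, mul_comm] at this
      exact this
    have h2 : density (Function.update ν a (ν a - 1)) = density ν := by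
      have := prod_update_mul (fun b x => (((x - 1).toNat.factorial : ℂ)⁻¹) •
        (coord b : smoothAlgebra p) ^ (x - 1).toNat) ν a (ν a - 1) (y := 1) (z := 1) (by
          have : (ν a - 1 - 1).toNat = (ν a - 1).toNat := by omega
          simp only [this])
      rwa [one_mul, one_mul] at this
    have h3 : ∏ b, Complex.I ^ max (Function.update ν a (ν a - 1) b) 1 =
        ∏ b, Complex.I ^ max (ν b) 1 := by
      have := prod_update_mul (fun _ x => Complex.I ^ max x 1) ν a (ν a - 1) (y := 1) (z := 1) (by
          have : max (ν a - 1) 1 = max (ν a) 1 := by omega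
          simp only [this])
      rwa [one_mul, one_mul] at this
    rw [pairing, pairing, h1, h2, h3, map_mul (smoothOp p), Module.End.mul_apply]
  · have h1 : symbol (Function.update ν a (ν a - 1)) = symbol ν := by
      have := prod_update_mul (fun b x => (MvPolynomial.X b : MvPolynomial (Fin p) ℂ) ^ (1 - x).toNat)
        ν a (ν a - 1) (y := 1) (z := 1) (by
          have : (1 - (ν a - 1)).toNat = (1 - ν a).toNat := by omega
          simp only [this])
      rwa [one_mul, one_mul] at this
    have h3 : Complex.I * ∏ b, Complex.I ^ max (Function.update ν a (ν a - 1) b) 1 =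
        ∏ b, Complex.I ^ max (ν b) 1 := by
      have := prod_update_mul (fun _ x => Complex.I ^ max x 1) ν a (ν a - 1) (y := Complex.I)
        (z := 1) (by
          rw [one_mul, ← zpow_one_add₀ Complex.I_ne_zero]; congr 1; omega)
      rwa [one_mul] at this
    have h4 : smoothOp p (symbol ν) (smoothOp p (MvPolynomial.X a) f) =
        Complex.I • pd a (smoothOp p (symbol ν) f) := by
      rw [← smoothOp_X, ← Module.End.mul_apply, ← Module.End.mul_apply, ← map_mul, ← map_mul,
        mul_comm]
    have h5 : ∫ s in orthant p, extendZero (density ν * (Complex.I •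
        pd a (smoothOp p (symbol ν) f))).1 s =
        Complex.I * ∫ s in orthant p, extendZero (density ν *
          pd a (smoothOp p (symbol ν) f)).1 s := by
      simp only [mul_smul_comm, extendZero_smul, integral_const_mul]
    rw [pairing, pairing, h1, h4, h5, ← h3, integral_by_parts hη hM hk (isRegular_symbol hf ν) ν a ha]
    linear_combination (-(∏ b, Complex.I ^ max (Function.update ν a (ν a - 1) b) 1) *
      ∫ s in orthant p, extendZero (density ν * pd a (smoothOp p (symbol ν) f)).1 s) *
      Complex.I_mul_I

theorem pairing_lower (m : Fin p →₀ ℕ) : ∀ {k : ℕ} {f : smoothAlgebra p}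
    (_ : (F.model S M (-D / 2)).IsRegular k f) (ν : Fin p → ℤ)
    (_ : ((k + 2 * (symbolDegree ν + m.degree) : ℕ) : ℝ) ≤ (-D / 2).re),
    pairing (fun a => ν a - m a) f = pairing ν (smoothOp p (MvPolynomial.monomial m 1) f) := by
  induction hN : m.degree generalizing m with
  | zero =>
    intro k f hf ν hk
    have : m = 0 := (Finsupp.degree_eq_zero_iff m).mp hN
    subst this
    simp
  | succ N ih =>
    intro k f hf ν hk
    obtain ⟨a, ha⟩ : ∃ a, m a ≠ 0 := by
      by_contra! h
      have : m = 0 := Finsupp.ext h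
      subst this
      simp at hN
    have hm : Finsupp.single a 1 + (m - Finsupp.single a 1) = m :=
      add_tsub_cancel_of_le (by simpa [Nat.one_le_iff_ne_zero] using ha)
    set m' := m - Finsupp.single a 1 with hm'
    have hdeg : m'.degree = N := by
      have := congrArg Finsupp.degree hm
      rw [map_add, hN, Finsupp.degree_single] at this
      omega
    have h1 : (fun b => ν b - (m b : ℤ)) = fun b => Function.update ν a (ν a - 1) b - (m' b : ℤ) := by
      ext b
      rw [← hm]
      by_cases hb : b = a
      · subst hb; simp; ring
      · simp [hb]
    have h2 : symbolDegree (Function.update ν a (ν a - 1)) ≤ symbolDegree ν + 1 := by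
      have h3 : symbolDegree ν + 1 = ∑ b, ((1 - ν b).toNat + if b = a then 1 else 0) := by
        simp [symbolDegree, Finset.sum_add_distrib]
      rw [h3]
      refine Finset.sum_le_sum fun b _ => ?_
      by_cases hb : b = a
      · subst hb; simp; omega
      · simp [hb]
    have hreg := hf.op_monomial m'
    rw [hdeg, CompleteFamily.model_op] at hreg
    rw [h1, ih m' hdeg hf (Function.update ν a (ν a - 1)) (le_trans (by
      exact_mod_cast (by omega)) hk), pairing_lower_one hη hM hreg ν (le_trans (by
      exact_mod_cast (by omega)) hk), ← Module.End.mul_apply, ← map_mul,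
      MvPolynomial.X, MvPolynomial.monomial_mul, hm, one_mul]

/-- Integrals of separate monomials may be added because each is absolutely convergent; the total
degree of `B` bounds the derivatives needed for all of them at once. -/
theorem sum_pairing_lower (B : MvPolynomial (Fin p) ℂ) {k : ℕ} {f : smoothAlgebra p}
    (hf : (F.model S M (-D / 2)).IsRegular k f) (ν : Fin p → ℤ)
    (hk : ((k + 2 * (symbolDegree ν + B.totalDegree) : ℕ) : ℝ) ≤ (-D / 2).re) :
    ∑ m ∈ B.support, B.coeff m * pairing (fun a => ν a - m a) f = pairing ν (smoothOp p B f) := by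
  have hle : ∀ m ∈ B.support, m.degree ≤ B.totalDegree := fun m hm => by
    rw [Finsupp.degree_eq_sum, ← Finsupp.sum_fintype _ (fun _ k => k) (by simp)]
    exact MvPolynomial.le_totalDegree hm
  have hint : ∀ m ∈ B.support, IntegrableOn (extendZero (density ν * smoothOp p (symbol ν)
      (smoothOp p (MvPolynomial.monomial m 1) f)).1) (orthant p) := fun m hm =>
    integrableOn_of_isRegular hη hM (le_trans (by
      have := hle m hm
      exact_mod_cast (by omega : k + 2 * m.degree + 2 * symbolDegree ν ≤
        k + 2 * (symbolDegree ν + B.totalDegree))) hk)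
      ((isRegular_symbol (hf.op_monomial m) ν).mul_poly (density_mem_polys _ ν))
  have h1 : smoothOp p B f =
      ∑ m ∈ B.support, B.coeff m • smoothOp p (MvPolynomial.monomial m 1) f := by
    conv_lhs => rw [B.as_sum, map_sum, LinearMap.sum_apply]
    refine Finset.sum_congr rfl fun m _ => ?_
    rw [← LinearMap.smul_apply, ← map_smul, MvPolynomial.smul_monomial, smul_eq_mul, mul_one]
  have h2 : ∑ m ∈ B.support, B.coeff m * ∫ s in orthant p, extendZero (density ν *
      smoothOp p (symbol ν) (smoothOp p (MvPolynomial.monomial m 1) f)).1 s =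
      ∫ s in orthant p, extendZero (density ν * smoothOp p (symbol ν) (smoothOp p B f)).1 s := by
    simp_rw [← integral_const_mul]
    rw [← integral_finsetSum _ fun m hm => (hint m hm).const_mul _, h1]
    simp only [map_sum, map_smul, Finset.mul_sum, mul_smul_comm, extendZero_sum, extendZero_smul]
  rw [pairing, ← h2, Finset.mul_sum]
  refine Finset.sum_congr rfl fun m hm => ?_
  rw [pairing_lower hη hM m hf ν (le_trans (by
    have := hle m hm
    exact_mod_cast (by omega)) hk), pairing]
  ring

end Lowering

theorem pairing_smul {p : ℕ} (ν : Fin p → ℤ) (c : ℂ) (f : smoothAlgebra p) :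
    pairing ν (c • f) = c * pairing ν f := by
  simp only [pairing, map_smul, mul_smul_comm, extendZero_smul, integral_const_mul]
  ring

/-- The dimensional recurrence in the region where the Schwinger representation converges. -/
theorem applyLowering_schwingerIntegral {L n p : ℕ} (F : CompleteFamily L n p)
    (S : Matrix (Fin n) (Fin n) ℝ) (hS : S.IsSymm) (hG : S.det ≠ 0) {M : Fin p → ℂ} {η : ℝ}
    (hη : 0 < η) (hM : ∀ a, (M a).im = -η) (ν : Fin p → ℤ) {D : ℂ}
    (hD : ((2 * (symbolDegree ν + (F.baikovPoly S M).totalDegree) : ℕ) : ℝ) ≤ (-D / 2).re) :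
    (-2) ^ L * applyLowering (F.baikovPoly S M) (fun ν => F.schwingerIntegral S M ν D) ν =
      S.det * (ascPochhammer ℂ L).eval (D - ((L + n : ℕ) : ℂ) + 1) *
        F.schwingerIntegral S M ν (D + 2) := by
  have h1 : (F.model S M (-D / 2)).E * (F.model S M (-D / 2)).G.det =
      (F.model S M (-(D + 2) / 2)).E := eval_ext fun s => by
    rw [F.eval_model_E_mul_det_G, F.eval_model_E]
  have h2 := sum_pairing_lower hη hM (F.baikovPoly S M) (F.model S M (-D / 2)).isRegular_E ν
    (by rwa [zero_add])
  rw [← F.model_op S M (-D / 2), KernelModel.op_baikovPoly _ hS hG, h1, pairing_smul] at h2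
  -- The prefactor `i ^ (-L D / 2)` changes by `(-i) ^ L` under `D → D + 2`. Matching this with the
  -- `(i/2) ^ L` from the Baikov operator is what requires `(-2) ^ L`.
  have h3 : Complex.exp (-(Real.pi * Complex.I * L * (D + 2) / 4)) =
      Complex.exp (-(Real.pi * Complex.I * L * D / 4)) * (-Complex.I) ^ L := by
    rw [← Complex.exp_neg_pi_div_two_mul_I, ← Complex.exp_nat_mul, ← Complex.exp_add]
    congr 1
    ring
  have h4 : (-2 : ℂ) ^ L * (Complex.I / 2) ^ L = (-Complex.I) ^ L := by
    rw [← mul_pow]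
    congr 1
    ring
  rw [applyLowering]
  simp only [schwingerIntegral_eq_pairing]
  simp only [mul_left_comm _ (Complex.exp _)]
  rw [← Finset.mul_sum, h2, h3, ← h4]
  ring

end FeynmanIntegral

/-! ### Continuation in the dimension and the limit of vanishing `η` -/

namespace FeynmanIntegral

namespace CompleteFamily

variable {L n p : ℕ} (F : CompleteFamily L n p)

/-- `dotPoly` for the squared masses `m_a ^ 2 - i η`, with `η` as an indeterminate. -/
noncomputable def dotPolyFamily (S : Matrix (Fin n) (Fin n) ℝ) (m2 : Fin p → ℝ) (e : DotIdx L n) :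
    MvPolynomial (Fin p) (Polynomial ℂ) :=
  ∑ a, MvPolynomial.C (Polynomial.C (F.dotCoeff e a : ℂ)) *
    (MvPolynomial.C (Polynomial.C ((m2 a : ℂ) - F.extSq S a) - Polynomial.C Complex.I * Polynomial.X)
      - MvPolynomial.X a)

/-- The Baikov polynomial for the squared masses `m_a ^ 2 - i η`, with `η` as an indeterminate. -/
noncomputable def baikovFamily (S : Matrix (Fin n) (Fin n) ℝ) (m2 : Fin p → ℝ) :
    MvPolynomial (Fin p) (Polynomial ℂ) :=
  (Matrix.fromBlocks
    (Matrix.of fun i j : Fin L => F.dotPolyFamily S m2 (Sum.inl s(i, j)))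
    (Matrix.of fun (i : Fin L) (r : Fin n) => F.dotPolyFamily S m2 (Sum.inr (i, r)))
    (Matrix.of fun (r : Fin n) (i : Fin L) => F.dotPolyFamily S m2 (Sum.inr (i, r)))
    (S.map fun x : ℝ => (MvPolynomial.C (Polynomial.C (x : ℂ)) :
      MvPolynomial (Fin p) (Polynomial ℂ)))).det

theorem map_dotPolyFamily (S : Matrix (Fin n) (Fin n) ℝ) (m2 : Fin p → ℝ) (η : ℝ)
    (e : DotIdx L n) :
    MvPolynomial.map (Polynomial.evalRingHom (η : ℂ)) (F.dotPolyFamily S m2 e) =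
      F.dotPoly S (fun a => m2 a - Complex.I * η) e := by
  rw [dotPolyFamily, dotPoly, map_sum]
  refine Finset.sum_congr rfl fun a _ => ?_
  simp only [map_mul, map_sub, MvPolynomial.map_C, MvPolynomial.map_X, Polynomial.coe_evalRingHom,
    Polynomial.eval_C, Polynomial.eval_X]
  rw [sub_right_comm (MvPolynomial.C (m2 a : ℂ))]
  rfl

theorem map_baikovFamily (S : Matrix (Fin n) (Fin n) ℝ) (m2 : Fin p → ℝ) (η : ℝ) :
    MvPolynomial.map (Polynomial.evalRingHom (η : ℂ)) (F.baikovFamily S m2) =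
      F.baikovPoly S (fun a => m2 a - Complex.I * η) := by
  rw [baikovFamily, baikovPoly, RingHom.map_det, RingHom.mapMatrix_apply, Matrix.fromBlocks_map]
  congr 2
  · ext1 i j; exact F.map_dotPolyFamily S m2 η _
  · ext1 i j; exact F.map_dotPolyFamily S m2 η _
  · ext1 i j; exact F.map_dotPolyFamily S m2 η _
  · ext1 i j; simp

/-- The sum runs over a support independent of `η`, with coefficients polynomial in `η`, so that
limits can be taken termwise. Monomials whose coefficient happens to vanish at a given `η`
contribute zero. -/
theorem applyLowering_baikovPoly (S : Matrix (Fin n) (Fin n) ℝ) (m2 : Fin p → ℝ) (η : ℝ)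
    (I : (Fin p → ℤ) → ℂ) (ν : Fin p → ℤ) :
    applyLowering (F.baikovPoly S fun a => m2 a - Complex.I * η) I ν =
      ∑ m ∈ (F.baikovFamily S m2).support,
        ((F.baikovFamily S m2).coeff m).eval (η : ℂ) * I (fun a => ν a - (m a : ℤ)) := by
  rw [applyLowering, ← map_baikovFamily]
  simp only [MvPolynomial.coeff_map, Polynomial.coe_evalRingHom]
  refine Finset.sum_subset (MvPolynomial.support_map_subset _ _) fun m _ hm => ?_
  rw [MvPolynomial.notMem_support_iff, MvPolynomial.coeff_map, Polynomial.coe_evalRingHom] at hm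
  rw [hm, zero_mul]

end CompleteFamily

/-- The zeros in `D` are the integers from `n` to `n + L - 1`, none of which is negative. -/
theorem ascPochhammer_eval_ne_zero (L n : ℕ) {D : ℂ} (hD : D.re < 0) :
    (ascPochhammer ℂ L).eval (D - ((L + n : ℕ) : ℂ) + 1) ≠ 0 := by
  have h : ∀ k ≤ L, (ascPochhammer ℂ k).eval (D - ((L + n : ℕ) : ℂ) + 1) ≠ 0 := by
    intro k
    induction k with
    | zero => simp
    | succ k ih =>
      intro hk
      rw [ascPochhammer_succ_eval]
      refine mul_ne_zero (ih (by omega)) fun h => ?_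
      have h1 := congrArg Complex.re h
      have h2 : (k : ℝ) + 1 ≤ L := by exact_mod_cast hk
      have h3 : (0 : ℝ) ≤ n := n.cast_nonneg
      simp at h1
      linarith
  exact h L le_rfl

end FeynmanIntegral

open FeynmanIntegral in
theorem mainTheorem6 {L n p : ℕ} (F : FeynmanIntegral.CompleteFamily L n p)
    (S : Matrix (Fin n) (Fin n) ℝ) (hS : S.IsSymm) (hG : S.det ≠ 0)
    (m2 : Fin p → ℝ) (hm : ∀ a, 0 < m2 a)
    (D₀ : ℕ) (ε D : ℂ) (hD : D = D₀ - 2 * ε)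
    (hP : (ascPochhammer ℂ L).eval (D - ((L + n : ℕ) : ℂ) + 1) ≠ 0)
    (ν : Fin p → ℤ) (I : (Fin p → ℤ) → ℂ)
    (hI : ∀ ν' ≤ ν, F.HasValue S m2 ν' D₀ ε (I ν')) :
    F.HasValue S m2 ν (D₀ + 2) ε
      ((-2) ^ L / ((S.det : ℂ) * (ascPochhammer ℂ L).eval (D - ((L + n : ℕ) : ℂ) + 1)) *
        FeynmanIntegral.applyLowering (F.baikovPoly S (fun a => (m2 a : ℂ))) I ν) := by
  have hSd : (S.det : ℂ) ≠ 0 := by exact_mod_cast hG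
  have hI' : ∀ m : Fin p →₀ ℕ, F.HasValue S m2 (fun a => ν a - (m a : ℤ)) D₀ ε
      (I fun a => ν a - (m a : ℤ)) := fun m => hI _ fun a => by simp
  choose J hJ hlim using hI'
  set B := F.baikovFamily S m2 with hB
  have hshift : ((D₀ + 2 : ℕ) : ℂ) - 2 * ε - 2 = D := by rw [hD]; push_cast; ring
  -- The continuation is defined by the recurrence itself, with the dimension shifted by two so that
  -- its argument is the raised dimension.
  refine ⟨fun η D => (-2) ^ L / ((S.det : ℂ) *
    (ascPochhammer ℂ L).eval (D - 2 - ((L + n : ℕ) : ℂ) + 1)) *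
    ∑ m ∈ B.support, (B.coeff m).eval (η : ℂ) * J m η (D - 2), ?_, ?_⟩
  · have hev := (Filter.eventually_all_finset (insert 0 B.support)).mpr fun m _ => hJ m
    filter_upwards [hev, self_mem_nhdsWithin] with η hη hη0
    have hη' : ∀ m ∈ B.support, _ := fun m hm => hη m (Finset.mem_insert_of_mem hm)
    have han : ∀ x : ℂ, AnalyticAt ℂ (fun D : ℂ => (S.det : ℂ) *
        (ascPochhammer ℂ L).eval (D - 2 - ((L + n : ℕ) : ℂ) + 1)) x := fun x => by
      have h1 : AnalyticAt ℂ (fun D : ℂ => D - 2 - ((L + n : ℕ) : ℂ) + 1) x := by fun_prop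
      have h2 := (AnalyticAt.aeval_polynomial h1 (ascPochhammer ℂ L))
      simp only [Polynomial.coe_aeval_eq_eval] at h2
      exact analyticAt_const.mul h2
    have hsub : ∀ x : ℂ, AnalyticAt ℂ (fun D : ℂ => D - 2) x := fun x => by fun_prop
    refine ⟨⟨fun x => ?_, ?_⟩, ?_⟩
    · refine ((MeromorphicAt.const _ x).div (han x).meromorphicAt).mul
        (MeromorphicAt.fun_sum fun m hm => ?_)
      exact (MeromorphicAt.const _ x).mul
        (((hη' m hm).1.1 (x - 2)).comp_analyticAt (f := J m η) (g := fun D => D - 2) (hsub x))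
    · have hR : ∀ m : Fin p →₀ ℕ, ∃ R : ℝ, m ∈ insert 0 B.support → ∀ D : ℂ, D.re < R →
          IntegrableOn (F.schwingerIntegrand S (fun a => m2 a - Complex.I * η)
            (fun a => ν a - (m a : ℤ)) D) (orthant p) ∧
          J m η D = F.schwingerIntegral S (fun a => m2 a - Complex.I * η)
            (fun a => ν a - (m a : ℤ)) D := fun m => by
        by_cases hm : m ∈ insert 0 B.support
        · obtain ⟨R, hR⟩ := (hη m hm).1.2
          exact ⟨R, fun _ => hR⟩
        -- A dummy threshold for indices outside the finite set.
        · exact ⟨0, fun h => absurd h hm⟩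
      choose R hR using hR
      obtain ⟨R₀, hR₀⟩ := ((insert 0 B.support).image fun m => -R m).exists_le
      set N : ℕ := 2 * (symbolDegree ν +
        (F.baikovPoly S fun a => m2 a - Complex.I * η).totalDegree) with hN
      -- The three bounds ensure, in turn, that all the chosen continuations agree with their
      -- Schwinger integrals, that the Pochhammer factor at `x - 2` is nonzero, and that enough
      -- powers of `𝒰` are available for the recurrence.
      refine ⟨min (-R₀) (min 0 (-2 * N)), fun x hx => ?_⟩
      obtain ⟨hx1, hx2⟩ := lt_min_iff.mp hx
      obtain ⟨hx2, hx3⟩ := lt_min_iff.mp hx2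
      have hxR : ∀ m ∈ insert 0 B.support, x.re < R m := fun m hm =>
        hx1.trans_le (neg_le.mp (hR₀ _ (Finset.mem_image_of_mem _ hm)))
      have hre : (x - 2).re = x.re - 2 := by simp
      refine ⟨by simpa using (hR 0 (Finset.mem_insert_self _ _) x
        (hxR 0 (Finset.mem_insert_self _ _))).1, ?_⟩
      have hpoch := ascPochhammer_eval_ne_zero L n (D := x - 2) (by rw [hre]; linarith)
      have hrec := applyLowering_schwingerIntegral F S hS hG (η := η)
        (M := fun a => m2 a - Complex.I * η) hη0 (by simp) ν (D := x - 2) (by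
          have h1 : (-(x - 2) / 2).re = -(x - 2).re / 2 := by
            rw [show -(x - 2) / 2 = ((-(2⁻¹) : ℝ) : ℂ) * (x - 2) by push_cast; ring,
              Complex.re_ofReal_mul]
            ring
          rw [← hN, h1, hre]
          linarith)
      rw [F.applyLowering_baikovPoly, sub_add_cancel] at hrec
      have hsum : ∑ m ∈ B.support, (B.coeff m).eval (η : ℂ) * J m η (x - 2) =
          ∑ m ∈ B.support, (B.coeff m).eval (η : ℂ) * F.schwingerIntegral S
            (fun a => m2 a - Complex.I * η) (fun a => ν a - (m a : ℤ)) (x - 2) := by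
        refine Finset.sum_congr rfl fun m hm => ?_
        have hm' := Finset.mem_insert_of_mem (b := 0) hm
        rw [(hR m hm' (x - 2) (by rw [hre]; linarith [hxR m hm'])).2]
      simp only [hsum]
      rw [div_mul_eq_mul_div, hrec, mul_div_cancel_left₀ _ (mul_ne_zero hSd hpoch)]
    -- At the target point the shifted argument is `D`: there `hP` keeps the denominator nonzero,
    -- and each lowered integral is analytic by assumption.
    · refine (analyticAt_const.div (han _) ?_).mul
        (Finset.analyticAt_fun_sum _ fun m hm => analyticAt_const.mul ?_)
      · rw [hshift]
        exact mul_ne_zero hSd hP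
      · refine AnalyticAt.fun_comp (g := J m η) ?_ (hsub _)
        rw [hshift, hD]
        exact (hη' m hm).2
  · simp only [hshift]
    -- The Baikov polynomial for real masses is the member `η = 0` of the family, so continuity of
    -- its coefficients identifies the limit.
    have h0 : F.baikovPoly S (fun a => (m2 a : ℂ)) =
        F.baikovPoly S (fun a => m2 a - Complex.I * (0 : ℝ)) := by simp
    rw [h0, F.applyLowering_baikovPoly]
    have hterm : ∀ m ∈ B.support, Tendsto (fun η : ℝ => (B.coeff m).eval (η : ℂ) *
        (Complex.exp (Real.eulerMascheroniConstant * L * ε) * J m η D)) (𝓝[>] 0)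
        (𝓝 ((B.coeff m).eval ((0 : ℝ) : ℂ) * I fun a => ν a - (m a : ℤ))) := fun m _ => by
      refine Tendsto.mul ?_ (by rw [hD]; exact hlim m)
      have hc : Continuous fun η : ℝ => (B.coeff m).eval (η : ℂ) :=
        (B.coeff m).continuous.comp Complex.continuous_ofReal
      exact (hc.tendsto 0).mono_left nhdsWithin_le_nhds
    refine ((tendsto_finsetSum _ hterm).const_mul _).congr fun η => ?_
    simp only [Finset.mul_sum]
    exact Finset.sum_congr rfl fun m _ => by ring
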